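/- **Language.** Fix a set $S$ of functions $f\colon\mathbb R^{\mathrm{ar}(f)}\to\mathbb R$ with $\mathrm{ar}(f)\ge 1$ and $|f(\vec a)-f(\vec b)|\le\sum_i|a_i-b_i|$. The linear $\lambda$-calculus $\Lambda_S$ has types $\tau,\sigma::=\mathbf R\mid\mathbf I\mid\tau\multimap\sigma\mid\tau\otimes\sigma$ and terms $$M,N::=x\mid\overline a\mid *\mid\overline f(M_1,\dots,M_{\mathrm{ar}(f)})\mid M\,N\mid\lambda x{:}\tau.M\mid M\otimes N\mid\mathsf{let}\ *\ \mathsf{be}\ M\ \mathsf{in}\ N\mid\mathsf{let}\ x\otimes y\ \mathsf{be}\ M\ \mathsf{in}\ N\qquad(a\in\mathbb R,\ f\in S).$$ Environments are lists of typed variables without repetition, and $\Gamma\#\Delta$ denotes any shuffle of $\Gamma$ and $\Delta$ (which share no variable) preserving both orders. Typing is linear: $x{:}\tau\vdash x:\tau$; $\vdash\overline a:\mathbf R$; $\vdash *:\mathbf I$; from $\Gamma_i\vdash M_i:\mathbf R$ infer $\Gamma_1\#\cdots\#\Gamma_n\vdash\overline f(M_1,\dots,M_n):\mathbf R$; from $\Gamma,x{:}\sigma\vdash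 M:\tau$ infer $\Gamma\vdash\lambda x{:}\sigma.M:\sigma\multimap\tau$; from $\Gamma\vdash M:\sigma\multimap\tau$ and $\Delta\vdash N:\sigma$ infer $\Gamma\#\Delta\vdash M\,N:\tau$; from $\Gamma\vdash M:\tau$ and $\Delta\vdash N:\sigma$ infer $\Gamma\#\Delta\vdash M\otimes N:\tau\otimes\sigma$; from $\Gamma\vdash M:\mathbf I$ and $\Delta\vdash N:\tau$ infer $\Gamma\#\Delta\vdash\mathsf{let}\ *\ \mathsf{be}\ M\ \mathsf{in}\ N:\tau$; from $\Gamma\vdash M:\sigma_1\otimes\sigma_2$ and $\Delta,x{:}\sigma_1,y{:}\sigma_2\vdash N:\tau$ infer $\Gamma\#\Delta\vdash\mathsf{let}\ x\otimes y\ \mathsf{be}\ M\ \mathsf{in}\ N:\tau$. Derivations are unique. Let $\mathbf{Term}(\Gamma,\tau)$ be the set of $M$ with $\Gamma\vdash M:\tau$. Values are $V,U::=\overline a\mid *\mid\lambda x{:}\tau.M\mid V\otimes U$. Evaluation $\hookrightarrow$ is generated by: $V\hookrightarrow V$; if $M_i\hookrightarrow\overline{a_i}$ for all $i$ then $\overline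 f(M_1,\dots,M_n)\hookrightarrow\overline{f(a_1,\dots,a_n)}$; if $M\hookrightarrow\lambda x{:}\tau.L$, $N\hookrightarrow V$ and $L[V/x]\hookrightarrow U$ then $M\,N\hookrightarrow U$; if $M\hookrightarrow V$ and $N\hookrightarrow U$ then $M\otimes N\hookrightarrow V\otimes U$; if $M\hookrightarrow *$ and $N\hookrightarrow V$ then $\mathsf{let}\ *\ \mathsf{be}\ M\ \mathsf{in}\ N\hookrightarrow V$; if $M\hookrightarrow V\otimes U$ and $N[V/x,U/y]\hookrightarrow W$ then $\mathsf{let}\ x\otimes y\ \mathsf{be}\ M\ \mathsf{in}\ N\hookrightarrow W$. A context $C[-]$ is a term with one hole (filling may capture variables); $C[-]\colon(\Gamma,\tau)\to(\Delta,\sigma)$ means that $\Delta\vdash C[M]:\sigma$ for every $M\in\mathbf{Term}(\Gamma,\tau)$. The equational theory $\Gamma\vdash M=N:\tau$ relates terms $M,N\in\mathbf{Term}(\Gamma,\tau)$. It is the least equivalence that contains renaming of bound variables, is closed under contexts (if $\Gamma\vdash M=N:\tau$ and $C[-]\colon(\Gamma,\tau)\to(\Delta,\sigma)$ then $\Delta\vdash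 C[M]=C[N]:\sigma$), and satisfies, whenever both sides are typed in the same environment and type: $\overline f(\overline{a_1},\dots,\overline{a_n})=\overline b$ if $f(a_1,\dots,a_n)=b$; $(\lambda x{:}\tau.M)N=M[N/x]$; $\lambda x{:}\tau.M\,x=M$ ($x$ not free in $M$); $\mathsf{let}\ *\ \mathsf{be}\ *\ \mathsf{in}\ M=M$; $\mathsf{let}\ *\ \mathsf{be}\ M\ \mathsf{in}\ *=M$; $\mathsf{let}\ x\otimes y\ \mathsf{be}\ M\otimes N\ \mathsf{in}\ L=L[M/x,N/y]$; $\mathsf{let}\ x\otimes y\ \mathsf{be}\ M\ \mathsf{in}\ x\otimes y=M$; $\mathsf{let}\ *\ \mathsf{be}\ M\ \mathsf{in}\ C[N]=C[\mathsf{let}\ *\ \mathsf{be}\ M\ \mathsf{in}\ N]$ and $\mathsf{let}\ x\otimes y\ \mathsf{be}\ M\ \mathsf{in}\ C[N]=C[\mathsf{let}\ x\otimes y\ \mathsf{be}\ M\ \mathsf{in}\ N]$, where $C$ binds at its hole no free variable of $M$ and neither $x$ nor $y$. Substitution is capture-avoiding. **Admissibility.** "Metric" means extended pseudo-metric (values in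 $[0,\infty]$, distance $0$ between distinct points allowed). A family of metrics $d_{\Gamma,\tau}$ on the sets $\mathbf{Term}(\Gamma,\tau)$ is *admissible* if: (A1) $d_{\Delta,\sigma}(C[M],C[N])\le d_{\Gamma,\tau}(M,N)$ for all $M,N\in\mathbf{Term}(\Gamma,\tau)$ and $C[-]\colon(\Gamma,\tau)\to(\Delta,\sigma)$; (A2) $d_{\varnothing,\mathbf R}(\overline a,\overline b)=|a-b|$; (A3) $d_{\varnothing,\mathbf R^{\otimes n}\otimes\tau}(\overline{a_1}\otimes\cdots\otimes\overline{a_n}\otimes V,\ \overline{b_1}\otimes\cdots\otimes\overline{b_n}\otimes U)\ge\sum_i|a_i-b_i|$ for all reals $a_i,b_i$ and closed values $V,U$ of type $\tau$; (A4) $d_{\Gamma,\tau}(M,N)=0$ if $\Gamma\vdash M=N:\tau$. **Models.** Let $\mathbf{Met}$ be the category of extended pseudo-metric spaces and non-expansive maps, with the sum metric on $X\otimes Y$. A symmetric monoidal closed category $(\mathcal C,I,\otimes,\multimap)$ is $\mathbf{Met}$-enriched if its hom-sets are metric spaces such that composition and tensor are non-expansive maps $\mathcal C(X,Y)\otimes\mathcal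 C(Z,X)\to\mathcal C(Z,Y)$ and $\mathcal C(X,Y)\otimes\mathcal C(Z,W)\to\mathcal C(X\otimes Z,Y\otimes W)$, and currying $\mathcal C(X\otimes Y,Z)\to\mathcal C(X,Y\multimap Z)$ is an isometric bijection. A *pre-model* $\mathcal M$ of $\Lambda_S$ is such a category with an object $\lfloor\mathbf R\rfloor$ and morphisms $\lfloor a\rfloor\colon I\to\lfloor\mathbf R\rfloor$ ($a\in\mathbb R$) and $\lfloor f\rfloor\colon\lfloor\mathbf R\rfloor^{\otimes\mathrm{ar}(f)}\to\lfloor\mathbf R\rfloor$ ($f\in S$). Types are interpreted by $[\![\mathbf R]\!]=\lfloor\mathbf R\rfloor$, $[\![\mathbf I]\!]=I$ and compositionally for $\otimes,\multimap$; environments by tensor products; and $\Gamma\vdash M:\tau$ by the standard interpretation $[\![M]\!]\colon[\![\Gamma]\!]\to[\![\tau]\!]$ of the linear $\lambda$-calculus in a symmetric monoidal closed category, with $[\![\overline a]\!]=\lfloor a\rfloor$ and $[\![\overline f(M_1,\dots,M_n)]\!]=\lfloor f\rfloor\circ([\![M_1]\!]\otimes\cdots\otimes[\![M_n]\!])\circ\theta$,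 where $\theta\colon[\![\Gamma_1\#\cdots\#\Gamma_n]\!]\cong[\![\Gamma_1]\!]\otimes\cdots\otimes[\![\Gamma_n]\!]$ is the canonical permutation. A pre-model is a *model* if (M1) $[\![\overline f(\overline{a_1},\dots,\overline{a_n})]\!]=[\![\overline b]\!]$ whenever $f\in S$ and $f(a_1,\dots,a_n)=b$; (M2) $d(\lfloor a\rfloor,\lfloor b\rfloor)=|a-b|$ for all $a,b\in\mathbb R$; (M3) $d(\lfloor a_1\rfloor\otimes\cdots\otimes\lfloor a_n\rfloor\otimes x,\ \lfloor b_1\rfloor\otimes\cdots\otimes\lfloor b_n\rfloor\otimes y)\ge\sum_i|a_i-b_i|$ for all $x,y\colon I\to X$ in $\mathcal C$ and all reals $a_i,b_i$. **Proposition.** Let $\mathcal M$ be a model of $\Lambda_S$. (i) (Soundness) For every closed term $M$ and every closed value $V$ of a type $\tau$, if $M\hookrightarrow V$, then $[\![M]\!]=[\![V]\!]$. (ii) For all $\Gamma$ and $\tau$, $d^{\mathcal M}_{\Gamma,\tau}(M,N):=d([\![M]\!],[\![N]\!])$ is a metric on $\mathbf{Term}(\Gamma,\tau)$, and the family $\{d^{\mathcal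 M}_{\Gamma,\tau}\}_{\Gamma,\tau}$ is admissible. -/

import Mathlib

open CategoryTheory MonoidalCategory
open scoped ENNReal

universe v u

namespace LambdaS

/-! ### Syntax of the linear language -/

/-- A function symbol: a function `ℝ ^ ar → ℝ` of arity `ar = n + 1 ≥ 1` that is non-expansive when
`ℝ ^ ar` carries the `ℓ¹` metric (the metric of the `ar`-fold tensor product in `Met`). -/
structure FunSym where
  n : ℕ
  fn : (Fin (n + 1) → ℝ) → ℝ
  nonexpansive : ∀ a b, |fn a - fn b| ≤ ∑ i, |a i - b i|

/-- Types `R`, `I`, `τ ⊸ σ`, `τ ⊗ σ`. -/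
inductive Ty where
  | R : Ty
  | I : Ty
  | lolli : Ty → Ty → Ty
  | tensor : Ty → Ty → Ty

/-- Variables: a countably infinite set. -/
abbrev Var := ℕ

/-- Environments, written with the most recent variable first: the list `(x, τ) :: Γ` is the
environment `Γ, x : τ`. That no variable is repeated is enforced by the typing rules (the
judgement is not derivable for any other list). -/
abbrev Env := List (Var × Ty)

/-- The variables of an environment. -/
def Env.vars (Γ : Env) : List Var := Γ.map Prod.fst

/-- Raw terms with named variables over a set `S` of function symbols. -/
inductive Tm (S : Set FunSym) where
  | var : Var → Tm S
  | num : ℝ → Tm S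
  | star : Tm S
  | fn : (f : S) → (Fin (f.1.n + 1) → Tm S) → Tm S
  | app : Tm S → Tm S → Tm S
  | lam : Var → Ty → Tm S → Tm S
  | tensor : Tm S → Tm S → Tm S
  /-- `let * be M in N` -/
  | letStar : Tm S → Tm S → Tm S
  /-- `let x ⊗ y be M in N` -/
  | letPair : Var → Var → Tm S → Tm S → Tm S

/-- Free variables. -/
def Tm.fv {S : Set FunSym} : Tm S → Finset Var
  | .var x => {x}
  | .num _ => ∅
  | .star => ∅
  | .fn _ Ms => Finset.univ.biUnion fun i => (Ms i).fv
  | .app M N => M.fv ∪ N.fv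
  | .lam x _ M => M.fv.erase x
  | .tensor M N => M.fv ∪ N.fv
  | .letStar M N => M.fv ∪ N.fv
  | .letPair x y M N => M.fv ∪ (N.fv.erase x).erase y

/-- The variable `x` itself if it is not in `A`, and otherwise a variable outside `A`. -/
def pick (x : Var) (A : Finset Var) : Var := if x ∈ A then A.sup id + 1 else x

/-- Capture-avoiding simultaneous substitution. -/
def Tm.subst {S : Set FunSym} : Tm S → (Var → Tm S) → Tm S
  | .var x, ρ => ρ x
  | .num a, _ => .num a
  | .star, _ => .star
  | .fn f Ms, ρ => .fn f fun i => (Ms i).subst ρ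
  | .app M N, ρ => .app (M.subst ρ) (N.subst ρ)
  | .lam x τ M, ρ =>
      let x' := pick x ((M.fv.erase x).biUnion fun w => (ρ w).fv)
      .lam x' τ (M.subst (Function.update ρ x (.var x')))
  | .tensor M N, ρ => .tensor (M.subst ρ) (N.subst ρ)
  | .letStar M N, ρ => .letStar (M.subst ρ) (N.subst ρ)
  | .letPair x y M N, ρ =>
      let A := ((N.fv.erase x).erase y).biUnion fun w => (ρ w).fv
      let x' := pick x A
      let y' := pick y (insert x' A)
      .letPair x' y' (M.subst ρ)
        (N.subst (Function.update (Function.update ρ x (.var x')) y (.var y')))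

/-- `M[N/x]` -/
def Tm.subst1 {S : Set FunSym} (M : Tm S) (x : Var) (N : Tm S) : Tm S :=
  M.subst (Function.update Tm.var x N)

/-- `M[N/x, L/y]` (simultaneous) -/
def Tm.subst2 {S : Set FunSym} (M : Tm S) (x : Var) (N : Tm S) (y : Var) (L : Tm S) : Tm S :=
  M.subst (Function.update (Function.update Tm.var x N) y L)

/-- Values. -/
inductive IsValue {S : Set FunSym} : Tm S → Prop
  | num (a : ℝ) : IsValue (.num a)
  | star : IsValue .star
  | lam (x : Var) (τ : Ty) (M : Tm S) : IsValue (.lam x τ M)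
  | tensor {V U : Tm S} : IsValue V → IsValue U → IsValue (.tensor V U)

/-- Contexts: terms with exactly one hole. In `fn f i Ms C` the hole is in the `i`-th argument, and
the entry `Ms i` is not part of the context. -/
inductive Ctx (S : Set FunSym) where
  | hole : Ctx S
  | fn : (f : S) → Fin (f.1.n + 1) → (Fin (f.1.n + 1) → Tm S) → Ctx S → Ctx S
  | appL : Ctx S → Tm S → Ctx S
  | appR : Tm S → Ctx S → Ctx S
  | lam : Var → Ty → Ctx S → Ctx S
  | tensorL : Ctx S → Tm S → Ctx S
  | tensorR : Tm S → Ctx S → Ctx S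
  | letStarL : Ctx S → Tm S → Ctx S
  | letStarR : Tm S → Ctx S → Ctx S
  | letPairL : Var → Var → Ctx S → Tm S → Ctx S
  | letPairR : Var → Var → Tm S → Ctx S → Ctx S

/-- `C[M]`: the hole is replaced literally, so that `C` may bind free variables of `M`. -/
def Ctx.fill {S : Set FunSym} : Ctx S → Tm S → Tm S
  | .hole, M => M
  | .fn f i Ms C, M => .fn f (Function.update Ms i (C.fill M))
  | .appL C N, M => .app (C.fill M) N
  | .appR N C, M => .app N (C.fill M)
  | .lam x τ C, M => .lam x τ (C.fill M)
  | .tensorL C N, M => .tensor (C.fill M) N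
  | .tensorR N C, M => .tensor N (C.fill M)
  | .letStarL C N, M => .letStar (C.fill M) N
  | .letStarR N C, M => .letStar N (C.fill M)
  | .letPairL x y C N, M => .letPair x y (C.fill M) N
  | .letPairR x y N C, M => .letPair x y N (C.fill M)

/-- The variables that the context binds at its hole. -/
def Ctx.bound {S : Set FunSym} : Ctx S → Finset Var
  | .hole => ∅
  | .fn _ _ _ C => C.bound
  | .appL C _ => C.bound
  | .appR _ C => C.bound
  | .lam x _ C => insert x C.bound
  | .tensorL C _ => C.bound
  | .tensorR _ C => C.bound
  | .letStarL C _ => C.bound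
  | .letStarR _ C => C.bound
  | .letPairL _ _ C _ => C.bound
  | .letPairR x y _ C => insert x (insert y C.bound)

/-! ### Typing -/

/-- `Merge Γ Δ Ξ`: `Ξ` is a merge `Γ # Δ`, that is a shuffle of `Γ` and `Δ` that keeps the order of
both and in which no variable is repeated. -/
inductive Merge : Env → Env → Env → Type
  | nil : Merge [] [] []
  | left {Γ Δ Ξ : Env} (x : Var) (τ : Ty) (hx : x ∉ Ξ.vars) :
      Merge Γ Δ Ξ → Merge ((x, τ) :: Γ) Δ ((x, τ) :: Ξ)
  | right {Γ Δ Ξ : Env} (x : Var) (τ : Ty) (hx : x ∉ Ξ.vars) :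
      Merge Γ Δ Ξ → Merge Γ ((x, τ) :: Δ) ((x, τ) :: Ξ)

/-- `MergeN Γs Ξ`: `Ξ` is an iterated merge `Γ₁ # ⋯ # Γₙ₊₁`. -/
inductive MergeN : {n : ℕ} → (Fin (n + 1) → Env) → Env → Type
  | single (Γs : Fin (0 + 1) → Env) : MergeN Γs (Γs 0)
  | snoc {n : ℕ} (Γs : Fin (n + 1 + 1) → Env) {Γ Ξ : Env} :
      MergeN (fun i => Γs i.castSucc) Γ → Merge Γ (Γs (Fin.last (n + 1))) Ξ → MergeN Γs Ξ

/-- Derivations of `Γ ⊢ M : τ`. -/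
inductive Deriv {S : Set FunSym} : Env → Tm S → Ty → Type
  | var (x : Var) (τ : Ty) : Deriv [(x, τ)] (.var x) τ
  | num (a : ℝ) : Deriv [] (.num a) .R
  | star : Deriv [] .star .I
  | fn (f : S) {Γs : Fin (f.1.n + 1) → Env} {Ms : Fin (f.1.n + 1) → Tm S} {Ξ : Env} :
      (∀ i, Deriv (Γs i) (Ms i) .R) → MergeN Γs Ξ → Deriv Ξ (.fn f Ms) .R
  | lam {Γ : Env} {x : Var} {σ τ : Ty} {M : Tm S} :
      Deriv ((x, σ) :: Γ) M τ → Deriv Γ (.lam x σ M) (.lolli σ τ)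
  | app {Γ Δ Ξ : Env} {σ τ : Ty} {M N : Tm S} :
      Deriv Γ M (.lolli σ τ) → Deriv Δ N σ → Merge Γ Δ Ξ → Deriv Ξ (.app M N) τ
  | tensor {Γ Δ Ξ : Env} {σ τ : Ty} {M N : Tm S} :
      Deriv Γ M τ → Deriv Δ N σ → Merge Γ Δ Ξ → Deriv Ξ (.tensor M N) (.tensor τ σ)
  | letStar {Γ Δ Ξ : Env} {τ : Ty} {M N : Tm S} :
      Deriv Γ M .I → Deriv Δ N τ → Merge Γ Δ Ξ → Deriv Ξ (.letStar M N) τ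
  | letPair {Γ Δ Ξ : Env} {x y : Var} {σ₁ σ₂ τ : Ty} {M N : Tm S} :
      Deriv Γ M (.tensor σ₁ σ₂) → Deriv ((y, σ₂) :: (x, σ₁) :: Δ) N τ → Merge Γ Δ Ξ →
      Deriv Ξ (.letPair x y M N) τ

/-- `Γ ⊢ M : τ` -/
def Typed {S : Set FunSym} (Γ : Env) (M : Tm S) (τ : Ty) : Prop := Nonempty (Deriv Γ M τ)

/-- `Term(Γ, τ)` -/
abbrev Term (S : Set FunSym) (Γ : Env) (τ : Ty) := {M : Tm S // Typed Γ M τ}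

/-- `C[-] : (Γ, τ) → (Δ, σ)` -/
def Ctx.Maps {S : Set FunSym} (C : Ctx S) (Γ : Env) (τ : Ty) (Δ : Env) (σ : Ty) : Prop :=
  ∀ M : Tm S, Typed Γ M τ → Typed Δ (C.fill M) σ

/-! ### Uniqueness of typing derivations

This makes the interpretation of a typing judgement, defined below by recursion on its derivation,
independent of choices. -/

theorem Merge.nodup {Γ Δ Ξ : Env} (m : Merge Γ Δ Ξ) : Ξ.vars.Nodup := by
  induction m with
  | nil => simp [Env.vars]
  | left x τ hx m ih => exact List.nodup_cons.2 ⟨hx, ih⟩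
  | right x τ hx m ih => exact List.nodup_cons.2 ⟨hx, ih⟩

theorem Merge.mem_vars {Γ Δ Ξ : Env} (m : Merge Γ Δ Ξ) (z : Var) :
    z ∈ Ξ.vars ↔ z ∈ Γ.vars ∨ z ∈ Δ.vars := by
  induction m with
  | nil => simp [Env.vars]
  | left x τ hx m ih => simp_all [Env.vars, or_assoc]
  | right x τ hx m ih => simp_all [Env.vars]; tauto

theorem MergeN.mem_vars {n : ℕ} {Γs : Fin (n + 1) → Env} {Ξ : Env} (m : MergeN Γs Ξ) (z : Var) :
    z ∈ Ξ.vars ↔ ∃ i, z ∈ (Γs i).vars := by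
  induction m with
  | single Γs => exact ⟨fun h => ⟨0, h⟩, fun ⟨i, h⟩ => by rwa [Fin.fin_one_eq_zero i] at h⟩
  | snoc Γs m₁ m₂ ih =>
    rw [m₂.mem_vars, ih]
    exact (Fin.exists_fin_succ' (P := fun i => z ∈ (Γs i).vars)).symm

theorem MergeN.nodup {n : ℕ} {Γs : Fin (n + 1) → Env} {Ξ : Env} (m : MergeN Γs Ξ)
    (h : ∀ i, (Γs i).vars.Nodup) : Ξ.vars.Nodup := by
  cases m with
  | single => exact h 0
  | snoc _ _ m => exact m.nodup

theorem Deriv.nodup {S : Set FunSym} {Γ : Env} {M : Tm S} {τ : Ty} (D : Deriv Γ M τ) :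
    Γ.vars.Nodup := by
  induction D with
  | var | num | star => simp [Env.vars]
  | fn f Ds m ih => exact m.nodup ih
  | lam D ih => exact (List.nodup_cons.1 ih).2
  | app _ _ m | tensor _ _ m | letStar _ _ m | letPair _ _ m => exact m.nodup

theorem Deriv.mem_vars {S : Set FunSym} {Γ : Env} {M : Tm S} {τ : Ty} (D : Deriv Γ M τ) :
    ∀ z, z ∈ Γ.vars ↔ z ∈ M.fv := by
  induction D with
  | var | num | star => simp [Env.vars, Tm.fv]
  | fn f Ds m ih => intro z; simp [m.mem_vars, ih, Tm.fv]
  | @lam Γ x σ τ M D ih =>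
    intro z
    have hx : x ∉ Γ.vars := (List.nodup_cons.1 D.nodup).1
    have := ih z
    simp only [Env.vars, List.map_cons, List.mem_cons] at this hx
    simp only [Tm.fv, Finset.mem_erase, ← this, Env.vars]
    by_cases h : z = x
    · subst h; simp [hx]
    · simp [h]
  | app _ _ m ih₁ ih₂ | tensor _ _ m ih₁ ih₂ | letStar _ _ m ih₁ ih₂ =>
    intro z; simp [m.mem_vars, ih₁, ih₂, Tm.fv]
  | @letPair Γ Δ Ξ x y _ _ _ _ _ _ D m ih₁ ih₂ =>
    intro z
    have hn := D.nodup
    have := ih₂ z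
    simp only [Env.vars, List.map_cons, List.mem_cons, List.nodup_cons, not_or] at this hn
    simp only [Tm.fv, Finset.mem_union, Finset.mem_erase, ← this, m.mem_vars, ← ih₁]
    simp only [Env.vars]
    by_cases h : z = x
    · subst h; simp [hn]
    · by_cases h' : z = y
      · subst h'; simp [hn]
      · simp [h, h']

theorem Merge.unique {Γ Δ Ξ : Env} (m : Merge Γ Δ Ξ) : ∀ {Γ' Δ' : Env} (m' : Merge Γ' Δ' Ξ),
    (∀ z, z ∈ Γ.vars ↔ z ∈ Γ'.vars) → Γ = Γ' ∧ Δ = Δ' ∧ HEq m m' := by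
  induction m with
  | nil => intro Γ' Δ' m' h; cases m'; exact ⟨rfl, rfl, HEq.rfl⟩
  | @left Γ Δ Ξ x τ hx m ih =>
    intro Γ' Δ' m' h
    cases m' with
    | @left Γ' _ _ _ _ _ m' =>
      have h1 : x ∉ Γ.vars := fun hh => hx ((m.mem_vars x).2 (Or.inl hh))
      have h2 : x ∉ Γ'.vars := fun hh => hx ((m'.mem_vars x).2 (Or.inl hh))
      obtain ⟨rfl, rfl, h3⟩ := ih m' (fun z => by
        have := h z
        simp only [Env.vars, List.map_cons, List.mem_cons] at this h1 h2 ⊢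
        by_cases hz : z = x
        · subst hz; simp [h1, h2]
        · simpa [hz] using this)
      cases h3
      exact ⟨rfl, rfl, HEq.rfl⟩
    | right _ _ _ m' =>
      exact absurd ((m'.mem_vars x).2 (Or.inl ((h x).1 (by simp [Env.vars])))) hx
  | @right Γ Δ Ξ x τ hx m ih =>
    intro Γ' Δ' m' h
    cases m' with
    | left _ _ _ m' =>
      exact absurd ((m.mem_vars x).2 (Or.inl ((h x).2 (by simp [Env.vars])))) hx
    | right _ _ _ m' =>
      obtain ⟨rfl, rfl, h3⟩ := ih m' h
      cases h3
      exact ⟨rfl, rfl, HEq.rfl⟩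

theorem MergeN.unique {n : ℕ} {Γs : Fin (n + 1) → Env} {Ξ : Env} (m : MergeN Γs Ξ) :
    ∀ {Γs' : Fin (n + 1) → Env} {Ξ' : Env} (m' : MergeN Γs' Ξ'), Ξ = Ξ' →
      (∀ i z, z ∈ (Γs i).vars ↔ z ∈ (Γs' i).vars) → Γs = Γs' ∧ HEq m m' := by
  induction m with
  | single Γs =>
    intro Γs' Ξ' m' hΞ _
    cases m' with
    | single =>
      have : Γs = Γs' := funext fun i => by rw [Fin.fin_one_eq_zero i]; exact hΞ
      subst this
      exact ⟨rfl, HEq.rfl⟩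
  | snoc Γs m₁ m₂ ih =>
    intro Γs' Ξ' m' hΞ h
    cases m' with
    | snoc _ m₁' m₂' =>
      subst hΞ
      obtain ⟨rfl, h2, h3⟩ := m₂.unique m₂' (fun z => by
        rw [m₁.mem_vars, m₁'.mem_vars]; exact exists_congr fun i => h _ z)
      obtain ⟨h4, h5⟩ := ih m₁' rfl (fun i => h _)
      have : Γs = Γs' := funext fun i => by
        refine Fin.lastCases h2 (fun j => congrFun h4 j) i
      subst this
      cases h3
      cases h5
      exact ⟨rfl, HEq.rfl⟩

theorem Deriv.unique {S : Set FunSym} {Γ : Env} {M : Tm S} {τ : Ty} (D : Deriv Γ M τ) :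
    ∀ {τ' : Ty} (D' : Deriv Γ M τ'), τ = τ' ∧ HEq D D' := by
  induction D with
  | var | num | star => intro τ' D'; cases D'; exact ⟨rfl, HEq.rfl⟩
  | fn f Ds m ih =>
    intro τ' D'
    cases D' with
    | fn _ Ds' m' =>
      obtain ⟨rfl, h2⟩ := m.unique m' rfl (fun i z => by rw [(Ds i).mem_vars, (Ds' i).mem_vars])
      cases h2
      have : Ds = Ds' := funext fun i => eq_of_heq (ih i (Ds' i)).2
      subst this
      exact ⟨rfl, HEq.rfl⟩
  | lam D ih =>
    intro τ' D'
    cases D' with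
    | lam D' =>
      obtain ⟨rfl, h⟩ := ih D'
      cases h
      exact ⟨rfl, HEq.rfl⟩
  | app D₁ D₂ m ih₁ ih₂ =>
    intro τ' D'
    cases D' with
    | app D₁' D₂' m' =>
      obtain ⟨rfl, rfl, h⟩ := m.unique m' (fun z => by rw [D₁.mem_vars, D₁'.mem_vars])
      cases h
      obtain ⟨h, h₁⟩ := ih₁ D₁'
      cases h
      cases h₁
      obtain ⟨h, h₂⟩ := ih₂ D₂'
      cases h
      cases h₂
      exact ⟨rfl, HEq.rfl⟩
  | tensor D₁ D₂ m ih₁ ih₂ =>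
    intro τ' D'
    cases D' with
    | tensor D₁' D₂' m' =>
      obtain ⟨rfl, rfl, h⟩ := m.unique m' (fun z => by rw [D₁.mem_vars, D₁'.mem_vars])
      cases h
      obtain ⟨h, h₁⟩ := ih₁ D₁'
      cases h
      cases h₁
      obtain ⟨h, h₂⟩ := ih₂ D₂'
      cases h
      cases h₂
      exact ⟨rfl, HEq.rfl⟩
  | letStar D₁ D₂ m ih₁ ih₂ =>
    intro τ' D'
    cases D' with
    | letStar D₁' D₂' m' =>
      obtain ⟨rfl, rfl, h⟩ := m.unique m' (fun z => by rw [D₁.mem_vars, D₁'.mem_vars])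
      cases h
      obtain ⟨h, h₁⟩ := ih₁ D₁'
      cases h
      cases h₁
      obtain ⟨h, h₂⟩ := ih₂ D₂'
      cases h
      cases h₂
      exact ⟨rfl, HEq.rfl⟩
  | letPair D₁ D₂ m ih₁ ih₂ =>
    intro τ' D'
    cases D' with
    | letPair D₁' D₂' m' =>
      obtain ⟨rfl, rfl, h⟩ := m.unique m' (fun z => by rw [D₁.mem_vars, D₁'.mem_vars])
      cases h
      obtain ⟨h, h₁⟩ := ih₁ D₁'
      cases h
      cases h₁
      obtain ⟨h, h₂⟩ := ih₂ D₂'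
      cases h
      cases h₂
      exact ⟨rfl, HEq.rfl⟩

instance {S : Set FunSym} (Γ : Env) (M : Tm S) (τ : Ty) : Subsingleton (Deriv Γ M τ) :=
  ⟨fun D D' => eq_of_heq (D.unique D').2⟩

/-! ### Evaluation -/

/-- `M ↪ V` -/
inductive Eval {S : Set FunSym} : Tm S → Tm S → Prop
  | value {V : Tm S} : IsValue V → Eval V V
  | fn (f : S) {Ms : Fin (f.1.n + 1) → Tm S} {a : Fin (f.1.n + 1) → ℝ} :
      (∀ i, Eval (Ms i) (.num (a i))) → Eval (.fn f Ms) (.num (f.1.fn a))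
  | app {M N L V U : Tm S} {x : Var} {τ : Ty} :
      Eval M (.lam x τ L) → IsValue V → Eval N V → Eval (L.subst1 x V) U → Eval (.app M N) U
  | tensor {M N V U : Tm S} : Eval M V → Eval N U → Eval (.tensor M N) (.tensor V U)
  | letStar {M N V : Tm S} : Eval M .star → Eval N V → Eval (.letStar M N) V
  | letPair {M N V U W : Tm S} {x y : Var} :
      Eval M (.tensor V U) → Eval (N.subst2 x V y U) W → Eval (.letPair x y M N) W

/-! ### Equational theory -/

/-- `Γ ⊢ M = N : τ`, a relation between terms of type `τ` in environment `Γ`. -/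
inductive Equal {S : Set FunSym} : {Γ : Env} → {τ : Ty} → Term S Γ τ → Term S Γ τ → Prop
  | refl {Γ : Env} {τ : Ty} (M : Term S Γ τ) : Equal M M
  | symm {Γ : Env} {τ : Ty} {M N : Term S Γ τ} : Equal M N → Equal N M
  | trans {Γ : Env} {τ : Ty} {M N L : Term S Γ τ} : Equal M N → Equal N L → Equal M L
  /-- congruence -/
  | ctx {Γ Δ : Env} {τ σ : Ty} (C : Ctx S) (hC : C.Maps Γ τ Δ σ) {M N : Term S Γ τ} :
      Equal M N → Equal (⟨C.fill M.1, hC M.1 M.2⟩ : Term S Δ σ) ⟨C.fill N.1, hC N.1 N.2⟩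
  /-- renaming of bound variables -/
  | alphaLam {Γ : Env} {τ σ : Ty} {x z : Var} {M : Tm S} (hz : z ∉ (Tm.lam x σ M).fv)
      (h : Typed Γ (.lam x σ M) τ) (h' : Typed Γ (.lam z σ (M.subst1 x (.var z))) τ) :
      Equal ⟨_, h⟩ ⟨_, h'⟩
  | alphaLetPair {Γ : Env} {τ : Ty} {x y z w : Var} {M N : Tm S} (hzw : z ≠ w)
      (hz : z ∉ (N.fv.erase x).erase y) (hw : w ∉ (N.fv.erase x).erase y)
      (h : Typed Γ (.letPair x y M N) τ)
      (h' : Typed Γ (.letPair z w M (N.subst2 x (.var z) y (.var w))) τ) :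
      Equal ⟨_, h⟩ ⟨_, h'⟩
  /-- `f(a₁, …, aₙ) = b` -/
  | fn (f : S) (a : Fin (f.1.n + 1) → ℝ) (b : ℝ) (hb : f.1.fn a = b)
      (h : Typed [] (.fn f fun i => .num (a i)) .R) (h' : Typed [] (.num b) .R) :
      Equal ⟨_, h⟩ ⟨_, h'⟩
  /-- `(λ x : σ. M) N = M[N/x]` -/
  | beta {Γ : Env} {τ σ : Ty} {x : Var} {M N : Tm S} (h : Typed Γ (.app (.lam x σ M) N) τ)
      (h' : Typed Γ (M.subst1 x N) τ) : Equal ⟨_, h⟩ ⟨_, h'⟩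
  /-- `λ x : σ. M x = M` -/
  | eta {Γ : Env} {τ σ : Ty} {x : Var} {M : Tm S} (hx : x ∉ M.fv)
      (h : Typed Γ (.lam x σ (.app M (.var x))) (.lolli σ τ)) (h' : Typed Γ M (.lolli σ τ)) :
      Equal ⟨_, h⟩ ⟨_, h'⟩
  /-- `let * be * in M = M` -/
  | starBeta {Γ : Env} {τ : Ty} {M : Tm S} (h : Typed Γ (.letStar .star M) τ)
      (h' : Typed Γ M τ) : Equal ⟨_, h⟩ ⟨_, h'⟩
  /-- `let x ⊗ y be M ⊗ N in L = L[M/x, N/y]` -/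
  | pairBeta {Γ : Env} {τ : Ty} {x y : Var} {M N L : Tm S}
      (h : Typed Γ (.letPair x y (.tensor M N) L) τ) (h' : Typed Γ (L.subst2 x M y N) τ) :
      Equal ⟨_, h⟩ ⟨_, h'⟩
  /-- `let * be M in * = M` -/
  | starEta {Γ : Env} {M : Tm S} (h : Typed Γ (.letStar M .star) .I) (h' : Typed Γ M .I) :
      Equal ⟨_, h⟩ ⟨_, h'⟩
  /-- `let x ⊗ y be M in x ⊗ y = M` -/
  | pairEta {Γ : Env} {τ σ : Ty} {x y : Var} {M : Tm S}
      (h : Typed Γ (.letPair x y M (.tensor (.var x) (.var y))) (.tensor τ σ))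
      (h' : Typed Γ M (.tensor τ σ)) : Equal ⟨_, h⟩ ⟨_, h'⟩
  /-- `let * be M in C[N] = C[let * be M in N]`, where `C` captures no free variable of `M` -/
  | starComm {Γ : Env} {τ : Ty} {M N : Tm S} (C : Ctx S) (hM : Disjoint C.bound M.fv)
      (h : Typed Γ (.letStar M (C.fill N)) τ) (h' : Typed Γ (C.fill (.letStar M N)) τ) :
      Equal ⟨_, h⟩ ⟨_, h'⟩
  /-- `let x ⊗ y be M in C[N] = C[let x ⊗ y be M in N]`, where `C` captures no free variable of `M`
  and neither `x` nor `y` -/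
  | pairComm {Γ : Env} {τ : Ty} {x y : Var} {M N : Tm S} (C : Ctx S)
      (hM : Disjoint C.bound M.fv) (hx : x ∉ C.bound) (hy : y ∉ C.bound)
      (h : Typed Γ (.letPair x y M (C.fill N)) τ) (h' : Typed Γ (C.fill (.letPair x y M N)) τ) :
      Equal ⟨_, h⟩ ⟨_, h'⟩

/-! ### Admissible metrics -/

/-- A family of functions `d_{Γ,τ} : Term(Γ, τ) × Term(Γ, τ) → [0, ∞]`. -/
abbrev DistFamily (S : Set FunSym) := (Γ : Env) → (τ : Ty) → Term S Γ τ → Term S Γ τ → ℝ≥0∞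

/-- Every `d_{Γ,τ}` is an (extended pseudo-)metric. -/
structure IsMetric {S : Set FunSym} (d : DistFamily S) : Prop where
  self : ∀ Γ τ (M : Term S Γ τ), d Γ τ M M = 0
  symm : ∀ Γ τ (M N : Term S Γ τ), d Γ τ M N = d Γ τ N M
  triangle : ∀ Γ τ (M N L : Term S Γ τ), d Γ τ M L ≤ d Γ τ M N + d Γ τ N L

/-- The type `R ⊗ ⋯ ⊗ R` with `n + 1` factors (left associated). -/
def Ty.Rpow : ℕ → Ty
  | 0 => .R
  | n + 1 => .tensor (Ty.Rpow n) .R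

/-- The term `a₁ ⊗ ⋯ ⊗ aₙ₊₁` (left associated). -/
def Tm.nums {S : Set FunSym} : (n : ℕ) → (Fin (n + 1) → ℝ) → Tm S
  | 0, a => .num (a 0)
  | n + 1, a => .tensor (Tm.nums n fun i => a i.castSucc) (.num (a (Fin.last (n + 1))))

theorem typed_num {S : Set FunSym} (a : ℝ) : Typed (S := S) [] (.num a) .R := ⟨.num a⟩

theorem typed_nums {S : Set FunSym} : ∀ (n : ℕ) (a : Fin (n + 1) → ℝ),
    Typed (S := S) [] (.nums n a) (.Rpow n)
  | 0, a => typed_num (a 0)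
  | n + 1, a => ⟨.tensor (typed_nums n fun i => a i.castSucc).some (.num _) .nil⟩

theorem typed_tensor {S : Set FunSym} {M N : Tm S} {τ σ : Ty} (hM : Typed [] M τ)
    (hN : Typed [] N σ) : Typed [] (.tensor M N) (.tensor τ σ) :=
  ⟨.tensor hM.some hN.some .nil⟩

/-- A merge of empty environments. -/
def MergeN.nils : (n : ℕ) → MergeN (fun _ : Fin (n + 1) => ([] : Env)) []
  | 0 => .single _
  | n + 1 => .snoc _ (MergeN.nils n) .nil

theorem typed_fn_nums {S : Set FunSym} (f : S) (a : Fin (f.1.n + 1) → ℝ) :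
    Typed [] (.fn f fun i => .num (a i)) .R :=
  ⟨.fn f (fun i => .num (a i)) (MergeN.nils _)⟩

/-- The conditions (A1)–(A4) on a metric `d`. In (A3) the number of real constants is `n + 1`
(for the empty sequence the bound is `0 ≤ d`). -/
structure IsAdmissible {S : Set FunSym} (d : DistFamily S) : Prop where
  A1 : ∀ (Γ : Env) (τ : Ty) (M N : Term S Γ τ) (Δ : Env) (σ : Ty) (C : Ctx S)
    (hC : C.Maps Γ τ Δ σ),
    d Δ σ ⟨C.fill M.1, hC M.1 M.2⟩ ⟨C.fill N.1, hC N.1 N.2⟩ ≤ d Γ τ M N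
  A2 : ∀ a b : ℝ, d [] .R ⟨.num a, typed_num a⟩ ⟨.num b, typed_num b⟩ = ENNReal.ofReal |a - b|
  A3 : ∀ (n : ℕ) (a b : Fin (n + 1) → ℝ) (τ : Ty) (V U : Term S [] τ), IsValue V.1 →
    IsValue U.1 →
    ∑ i, ENNReal.ofReal |a i - b i| ≤
      d [] (.tensor (.Rpow n) τ)
        ⟨.tensor (.nums n a) V.1, typed_tensor (typed_nums n a) V.2⟩
        ⟨.tensor (.nums n b) U.1, typed_tensor (typed_nums n b) U.2⟩
  A4 : ∀ (Γ : Env) (τ : Ty) (M N : Term S Γ τ), Equal M N → d Γ τ M N = 0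

/-! ### Models -/

section Models

variable {C : Type u} [Category.{v} C] [MonoidalCategory C]

/-- `X₁ ⊗ ⋯ ⊗ Xₙ₊₁` (left associated). -/
def tens : (n : ℕ) → (Fin (n + 1) → C) → C
  | 0, X => X 0
  | n + 1, X => tens n (fun i => X i.castSucc) ⊗ X (Fin.last (n + 1))

/-- `g₁ ⊗ ⋯ ⊗ gₙ₊₁` (left associated). -/
def tensHom : (n : ℕ) → {X Y : Fin (n + 1) → C} → (∀ i, X i ⟶ Y i) → (tens n X ⟶ tens n Y)
  | 0, _, _, g => g 0
  | n + 1, _, _, g => tensHom n (fun i => g i.castSucc) ⊗ₘ g (Fin.last (n + 1))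

variable [SymmetricCategory C] [MonoidalClosed C]

/-- Currying `C(X ⊗ Y, Z) → C(X, Y ⊸ Z)`, where `Y ⊸ Z` is `(ihom Y).obj Z`. -/
def rcurry {X Y Z : C} (g : X ⊗ Y ⟶ Z) : X ⟶ (ihom Y).obj Z :=
  MonoidalClosed.curry ((β_ Y X).hom ≫ g)

/-- Evaluation `(Y ⊸ Z) ⊗ Y → Z`. -/
def reval (Y Z : C) : (ihom Y).obj Z ⊗ Y ⟶ Z :=
  (β_ ((ihom Y).obj Z) Y).hom ≫ (ihom.ev Y).app Z

variable (C) in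
/-- A symmetric monoidal closed category whose hom-sets carry extended pseudo-metrics is
`Met`-enriched: composition and tensor are non-expansive for the sum metric on pairs, and currying
(a bijection) is an isometry. -/
class MetEnriched [∀ X Y : C, PseudoEMetricSpace (X ⟶ Y)] : Prop where
  comp : ∀ {X Y Z : C} (g g' : X ⟶ Y) (h h' : Y ⟶ Z),
    edist (g ≫ h) (g' ≫ h') ≤ edist g g' + edist h h'
  tensor : ∀ {X Y Z W : C} (g g' : X ⟶ Y) (h h' : Z ⟶ W),
    edist (g ⊗ₘ h) (g' ⊗ₘ h') ≤ edist g g' + edist h h'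
  curry : ∀ {X Y Z : C} (g g' : X ⊗ Y ⟶ Z), edist (rcurry g) (rcurry g') = edist g g'

variable (S : Set FunSym) (C) in
/-- The data that turn a `Met`-enriched symmetric monoidal closed category into a pre-model: an
object `⌊R⌋` and morphisms `⌊a⌋ : I → ⌊R⌋` and `⌊f⌋ : ⌊R⌋ ⊗ ⋯ ⊗ ⌊R⌋ → ⌊R⌋`. -/
structure PreModel where
  real : C
  num : ℝ → (𝟙_ C ⟶ real)
  fn : ∀ f : S, tens f.1.n (fun _ => real) ⟶ real

namespace PreModel

variable {S : Set FunSym} (P : PreModel C S)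

/-- Interpretation of types. -/
def ty : Ty → C
  | .R => P.real
  | .I => 𝟙_ C
  | .lolli τ σ => (ihom (ty τ)).obj (ty σ)
  | .tensor τ σ => ty τ ⊗ ty σ

/-- Interpretation of environments: the tensor product of the types in order, starting from `I`. -/
def env : Env → C
  | [] => 𝟙_ C
  | (_, τ) :: Γ => env Γ ⊗ P.ty τ

/-- The isomorphism `θ : ⟦Γ # Δ⟧ → ⟦Γ⟧ ⊗ ⟦Δ⟧` that rearranges the factors. -/
def merge : {Γ Δ Ξ : Env} → Merge Γ Δ Ξ → (P.env Ξ ⟶ P.env Γ ⊗ P.env Δ)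
  | _, _, _, .nil => (λ_ (𝟙_ C)).inv
  | _, _, _, @Merge.left Γ Δ _ _ τ _ m =>
      (merge m ▷ P.ty τ) ≫ (α_ (P.env Γ) (P.env Δ) (P.ty τ)).hom ≫
        (P.env Γ ◁ (β_ (P.env Δ) (P.ty τ)).hom) ≫ (α_ (P.env Γ) (P.ty τ) (P.env Δ)).inv
  | _, _, _, @Merge.right Γ Δ _ _ τ _ m =>
      (merge m ▷ P.ty τ) ≫ (α_ (P.env Γ) (P.env Δ) (P.ty τ)).hom

/-- The isomorphism `θ : ⟦Γ₁ # ⋯ # Γₙ₊₁⟧ → ⟦Γ₁⟧ ⊗ ⋯ ⊗ ⟦Γₙ₊₁⟧`. -/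
def mergeN : {n : ℕ} → {Γs : Fin (n + 1) → Env} → {Ξ : Env} → MergeN Γs Ξ →
    (P.env Ξ ⟶ tens n fun i => P.env (Γs i))
  | _, _, _, .single Γs => 𝟙 (P.env (Γs 0))
  | _, _, _, .snoc Γs m₁ m₂ =>
      P.merge m₂ ≫ (mergeN m₁ ▷ P.env (Γs (Fin.last _)))

/-- Interpretation of typing derivations. -/
def interp : {Γ : Env} → {M : Tm S} → {τ : Ty} → Deriv Γ M τ → (P.env Γ ⟶ P.ty τ)
  | _, _, _, .var _ τ => (λ_ (P.ty τ)).hom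
  | _, _, _, .num a => P.num a
  | _, _, _, .star => 𝟙 (𝟙_ C)
  | _, _, _, .fn f Ds m => P.mergeN m ≫ tensHom f.1.n (fun i => interp (Ds i)) ≫ P.fn f
  | _, _, _, .lam D => rcurry (interp D)
  | _, _, _, @Deriv.app _ _ _ _ σ τ _ _ D₁ D₂ m =>
      P.merge m ≫ (interp D₁ ⊗ₘ interp D₂) ≫ reval (P.ty σ) (P.ty τ)
  | _, _, _, .tensor D₁ D₂ m => P.merge m ≫ (interp D₁ ⊗ₘ interp D₂)
  | _, _, _, @Deriv.letStar _ _ _ _ τ _ _ D₁ D₂ m =>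
      P.merge m ≫ (interp D₁ ⊗ₘ interp D₂) ≫ (λ_ (P.ty τ)).hom
  | _, _, _, @Deriv.letPair _ _ Δ _ _ _ σ₁ σ₂ _ _ _ D₁ D₂ m =>
      P.merge m ≫ (interp D₁ ▷ P.env Δ) ≫ (β_ (P.ty σ₁ ⊗ P.ty σ₂) (P.env Δ)).hom ≫
        (α_ (P.env Δ) (P.ty σ₁) (P.ty σ₂)).inv ≫ interp D₂

/-- `⟦Γ ⊢ M : τ⟧`, the interpretation of the unique derivation of the judgement. -/
noncomputable def den {Γ : Env} {M : Tm S} {τ : Ty} (h : Typed Γ M τ) : P.env Γ ⟶ P.ty τ :=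
  P.interp h.some

variable [∀ X Y : C, PseudoEMetricSpace (X ⟶ Y)]

/-- The conditions (M1)–(M3) that make a pre-model a model. In (M3) the number of real constants
is `n + 1` (for the empty sequence the bound is `0 ≤ d`). -/
structure IsModel : Prop where
  M1 : ∀ (f : S) (a : Fin (f.1.n + 1) → ℝ) (b : ℝ), f.1.fn a = b →
    P.den (typed_fn_nums f a) = P.den (typed_num b)
  M2 : ∀ a b : ℝ, edist (P.num a) (P.num b) = ENNReal.ofReal |a - b|
  M3 : ∀ (X : C) (x y : 𝟙_ C ⟶ X) (n : ℕ) (a b : Fin (n + 1) → ℝ),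
    ∑ i, ENNReal.ofReal |a i - b i| ≤
      edist (tensHom n (fun i => P.num (a i)) ⊗ₘ x) (tensHom n (fun i => P.num (b i)) ⊗ₘ y)

/-- The distance `d_{Γ,τ}(M, N) = d(⟦M⟧, ⟦N⟧)` on terms induced by a pre-model. -/
noncomputable def dist : DistFamily S := fun _ _ M N => edist (P.den M.2) (P.den N.2)

end PreModel

end Models

end LambdaS

/-! The distance is pulled back along M ↦ ⟦M⟧, so it is a metric, and (A2) is (M2). (A3) follows
from (M3): the interpretation of a₁ ⊗ ⋯ ⊗ aₙ differs from `tensHom` by isomorphisms that do not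
depend on the aᵢ, and composition with a fixed morphism is non-expansive. Soundness, (A1) and (A4)
rest on three facts about the interpretation.

Environments. Factors are rearranged by the isomorphisms `P.merge m`. Unit laws, symmetry
(`merge_symm`) and reassociation (`merge_assoc`, `merge_assoc_inv`) suffice; no coherence theorem
for arbitrary permutations is needed. Since derivations are unique, the relation `Den` is
functional, and an equation M = N is validated by transferring `Den` from one side to the other.

Substitution. A typed simultaneous substitution is a morphism ⟦Ω⟧ → ⟦Γ⟧ (`Sub`). It splits along
merges (`Sub.split`), whence substituting in a term is precomposition (`Den.subst`). This yields the
α and β rules, the reordering of environments (`Den.exchange`), and soundness by induction on the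
evaluation (`Den.eval`).

Contexts. A context with hole of type π in Θ is interpreted by a family of maps from C(A ⊗ ⟦Θ⟧, ⟦π⟧)
to C(A ⊗ ⟦Γ⟧, Y), natural in A and non-expansive, where A stands for variables that reach the hole
from outside (`Strength`, `Den.fillable`). Taking A = I gives (A1) and closure of the theory under
contexts (`exists_den_fill`). Naturality along ⟦M⟧ gives the commuting conversions: binding the
result of M outside or at the hole is the same composite. One difficulty is that C : (Γ, τ) → (Δ, σ)
only constrains the filled terms, so the typing of the hole must be recovered; filling the hole with
the term `force Γ M`, which annotates all its free variables, determines that typing up to the order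
of the environment. -/

namespace LambdaS

/-! ### Exchanging the last two factors of a tensor product -/

section Swap

variable {C : Type u} [Category.{v} C] [MonoidalCategory C] [SymmetricCategory C]

/-- The symmetry `(X ⊗ Y) ⊗ Z → (X ⊗ Z) ⊗ Y`. -/
def swapLast (X Y Z : C) : (X ⊗ Y) ⊗ Z ⟶ (X ⊗ Z) ⊗ Y :=
  (α_ X Y Z).hom ≫ (X ◁ (β_ Y Z).hom) ≫ (α_ X Z Y).inv

instance (X Y Z : C) : IsIso (swapLast X Y Z) := by unfold swapLast; infer_instance

theorem swapLast_natural_left {X X' : C} (f : X ⟶ X') (Y Z : C) :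
    swapLast X Y Z ≫ (f ▷ Z) ▷ Y = (f ▷ Y) ▷ Z ≫ swapLast X' Y Z := by
  simp only [swapLast, Category.assoc, ← associator_inv_naturality_left, whisker_exchange_assoc,
    associator_naturality_left_assoc]

theorem swapLast_natural_middle {Y Y' : C} (X : C) (f : Y ⟶ Y') (Z : C) :
    swapLast X Y Z ≫ (X ⊗ Z) ◁ f = (X ◁ f) ▷ Z ≫ swapLast X Y' Z := by
  simp only [swapLast, Category.assoc, associator_naturality_middle_assoc]
  rw [← associator_inv_naturality_right, ← MonoidalCategory.whiskerLeft_comp_assoc,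
    ← MonoidalCategory.whiskerLeft_comp_assoc, BraidedCategory.braiding_naturality_left]

/-- By the hexagon identity, moving `W` past `Z` and then past `Y` is moving it past `Y ⊗ Z`. -/
theorem swapLast_swapLast_associator (X Y Z W : C) :
    swapLast (X ⊗ Y) Z W ≫ swapLast X Y W ▷ Z ≫ (α_ (X ⊗ W) Y Z).hom =
      (α_ X Y Z).hom ▷ W ≫ swapLast X (Y ⊗ Z) W := by
  simp only [swapLast, BraidedCategory.braiding_tensor_left_hom]
  monoidal

theorem swapLast_associator (X Y Z W : C) :
    swapLast (X ⊗ Y) Z W ≫ (α_ X Y W).hom ▷ Z ≫ (α_ X (Y ⊗ W) Z).hom =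
      (α_ X Y Z).hom ▷ W ≫ (α_ X (Y ⊗ Z) W).hom ≫ X ◁ swapLast Y Z W := by
  simp only [swapLast]
  monoidal

theorem swapLast_braiding (X Y Z : C) :
    swapLast X Y Z ≫ (β_ (X ⊗ Z) Y).hom = (β_ X Y).hom ▷ Z ≫ (α_ Y X Z).hom := by
  simp only [swapLast, BraidedCategory.braiding_tensor_left_hom, Category.assoc,
    Iso.inv_hom_id_assoc, ← MonoidalCategory.whiskerLeft_comp_assoc, SymmetricCategory.symmetry]
  simp

theorem associator_braiding (X Y Z : C) :
    (α_ X Y Z).hom ≫ (β_ X (Y ⊗ Z)).hom = (β_ X Y).hom ▷ Z ≫ swapLast Y X Z := by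
  simp [swapLast]

end Swap

/-! ### Algebra of merges -/

theorem Merge.nodup_left {Γ Δ Ξ : Env} (m : Merge Γ Δ Ξ) : Γ.vars.Nodup := by
  induction m with
  | nil => simp [Env.vars]
  | left x τ hx m ih => exact List.nodup_cons.2 ⟨fun h => hx ((m.mem_vars x).2 (.inl h)), ih⟩
  | right x τ hx m ih => exact ih

theorem Merge.nodup_right {Γ Δ Ξ : Env} (m : Merge Γ Δ Ξ) : Δ.vars.Nodup := by
  induction m with
  | nil => simp [Env.vars]
  | left x τ hx m ih => exact ih
  | right x τ hx m ih => exact List.nodup_cons.2 ⟨fun h => hx ((m.mem_vars x).2 (.inr h)), ih⟩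

theorem Merge.mem {Γ Δ Ξ : Env} (m : Merge Γ Δ Ξ) (p : Var × Ty) : p ∈ Ξ ↔ p ∈ Γ ∨ p ∈ Δ := by
  induction m with
  | nil => simp
  | left x τ hx m ih => simp [ih, or_assoc]
  | right x τ hx m ih => simp [ih, or_left_comm]

theorem Env.nodup_cons {x : Var} {τ : Ty} {Γ : Env} :
    (Env.vars ((x, τ) :: Γ)).Nodup ↔ x ∉ Γ.vars ∧ Γ.vars.Nodup :=
  List.nodup_cons

/-- The merge of an environment with the empty one. -/
def Merge.nilLeft : (Γ : Env) → Γ.vars.Nodup → Merge [] Γ Γ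
  | [], _ => .nil
  | (x, τ) :: Γ, h => .right x τ (Env.nodup_cons.1 h).1 (nilLeft Γ (Env.nodup_cons.1 h).2)

/-- `Δ # Γ` from `Γ # Δ`. -/
def Merge.symm : {Γ Δ Ξ : Env} → Merge Γ Δ Ξ → Merge Δ Γ Ξ
  | _, _, _, .nil => .nil
  | _, _, _, .left x τ hx m => .right x τ hx m.symm
  | _, _, _, .right x τ hx m => .left x τ hx m.symm

namespace PreModel

variable {C : Type u} [Category.{v} C] [MonoidalCategory C] [SymmetricCategory C]
  [MonoidalClosed C] {S : Set FunSym} (P : PreModel C S)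

/-- Environments grow at the right end of the tensor product. A new variable of the left part must
therefore cross ⟦Δ⟧, while one of the right part (`merge_right`) is only reassociated. -/
theorem merge_left {Γ Δ Ξ : Env} (x : Var) (τ : Ty) (hx : x ∉ Ξ.vars) (m : Merge Γ Δ Ξ) :
    P.merge (.left x τ hx m) = P.merge m ▷ P.ty τ ≫ swapLast _ _ _ := by
  simp only [merge, swapLast]; rfl

theorem merge_right {Γ Δ Ξ : Env} (x : Var) (τ : Ty) (hx : x ∉ Ξ.vars) (m : Merge Γ Δ Ξ) :
    P.merge (.right x τ hx m) = P.merge m ▷ P.ty τ ≫ (α_ _ _ _).hom := by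
  simp only [merge]; rfl

instance isIso_merge {Γ Δ Ξ : Env} (m : Merge Γ Δ Ξ) : IsIso (P.merge m) := by
  induction m with
  | nil => exact inferInstanceAs (IsIso (λ_ (𝟙_ C)).inv)
  | left x τ hx m ih =>
    have := ih
    exact P.merge_left x τ hx m ▸
      (inferInstance : IsIso (P.merge m ▷ P.ty τ ≫ swapLast _ _ _))
  | right x τ hx m ih =>
    have := ih
    exact P.merge_right x τ hx m ▸
      (inferInstance : IsIso (P.merge m ▷ P.ty τ ≫ (α_ _ _ _).hom))

theorem merge_nilLeft : (Γ : Env) → (h : Γ.vars.Nodup) →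
    P.merge (.nilLeft Γ h) = (λ_ (P.env Γ)).inv
  | [], _ => by simp only [Merge.nilLeft, merge]; rfl
  | (x, τ) :: Γ, h => by
    rw [Merge.nilLeft, merge_right, merge_nilLeft Γ]
    simp only [env]
    monoidal

theorem merge_symm {Γ Δ Ξ : Env} (m : Merge Γ Δ Ξ) :
    P.merge m.symm = P.merge m ≫ (β_ _ _).hom := by
  induction m with
  | nil =>
    simp only [Merge.symm, merge, env]
    rw [leftUnitor_inv_braiding, unitors_inv_equal]
  | left x τ hx m ih =>
    rw [Merge.symm, merge_left, merge_right, ih]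
    simp only [env, Category.assoc, comp_whiskerRight, swapLast_braiding]
  | right x τ hx m ih =>
    rw [Merge.symm, merge_left, merge_right, ih]
    simp only [env, Category.assoc, comp_whiskerRight, associator_braiding]

theorem merge_nilLeft_symm (Γ : Env) (h : Γ.vars.Nodup) :
    P.merge (Merge.nilLeft Γ h).symm = (ρ_ (P.env Γ)).inv := by
  rw [merge_symm, merge_nilLeft]
  exact leftUnitor_inv_braiding _

/-- The head variable of `Ω` comes from `Γ`, `Δ` or `Θ`. The three cases reduce to
`swapLast_swapLast_associator`, `swapLast_associator` and the pentagon. -/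
theorem merge_assoc {Ξ Θ Ω : Env} (m₂ : Merge Ξ Θ Ω) : ∀ {Γ Δ : Env} (m₁ : Merge Γ Δ Ξ),
    ∃ (Ξ' : Env) (m₃ : Merge Δ Θ Ξ') (m₄ : Merge Γ Ξ' Ω),
      P.merge m₂ ≫ P.merge m₁ ▷ P.env Θ ≫ (α_ _ _ _).hom =
        P.merge m₄ ≫ P.env Γ ◁ P.merge m₃ := by
  induction m₂ with
  | nil =>
    intro Γ Δ m₁
    cases m₁
    refine ⟨_, .nil, .nil, ?_⟩
    simp only [merge, env]
    monoidal
  | @left Ξ Θ Ω x τ hx m₂ ih =>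
    intro Γ Δ m₁
    cases m₁ with
    | @left Γ _ _ _ _ hx₁ m₁ =>
      obtain ⟨Ξ', m₃, m₄, h⟩ := ih m₁
      refine ⟨_, m₃, .left x τ hx m₄, ?_⟩
      simp only [merge_left, env, comp_whiskerRight, Category.assoc,
        reassoc_of% @swapLast_natural_left, swapLast_swapLast_associator, swapLast_natural_middle]
      simp only [← comp_whiskerRight_assoc, h]
    | @right _ Δ _ _ _ hx₁ m₁ =>
      obtain ⟨Ξ', m₃, m₄, h⟩ := ih m₁
      have hx' : x ∉ Ξ'.vars := fun hh => hx ((m₄.mem_vars x).2 (.inr hh))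
      refine ⟨_, .left x τ hx' m₃, .right x τ hx m₄, ?_⟩
      simp only [merge_left, merge_right, env, comp_whiskerRight, Category.assoc,
        reassoc_of% @swapLast_natural_left, swapLast_associator, MonoidalCategory.whiskerLeft_comp,
        ← associator_naturality_middle_assoc]
      simp only [← comp_whiskerRight_assoc, h]
  | @right Ξ Θ Ω x τ hx m₂ ih =>
    intro Γ Δ m₁
    obtain ⟨Ξ', m₃, m₄, h⟩ := ih m₁
    have hx' : x ∉ Ξ'.vars := fun hh => hx ((m₄.mem_vars x).2 (.inr hh))
    refine ⟨_, .right x τ hx' m₃, .right x τ hx m₄, ?_⟩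
    simp only [merge_right, env, Category.assoc, MonoidalCategory.whiskerLeft_comp,
      ← associator_naturality_middle_assoc, ← associator_naturality_left_assoc]
    rw [← comp_whiskerRight_assoc, ← comp_whiskerRight_assoc, ← h]
    simp only [Category.assoc, comp_whiskerRight, pentagon]

theorem merge_assoc_inv {Γ Ξ' Ω : Env} (m₄ : Merge Γ Ξ' Ω) : ∀ {Δ Θ : Env} (m₃ : Merge Δ Θ Ξ'),
    ∃ (Ξ : Env) (m₁ : Merge Γ Δ Ξ) (m₂ : Merge Ξ Θ Ω),
      P.merge m₂ ≫ P.merge m₁ ▷ P.env Θ ≫ (α_ _ _ _).hom =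
        P.merge m₄ ≫ P.env Γ ◁ P.merge m₃ := by
  induction m₄ with
  | nil =>
    intro Δ Θ m₃
    cases m₃
    refine ⟨_, .nil, .nil, ?_⟩
    simp only [merge, env]
    monoidal
  | @left Γ Ξ' Ω x τ hx m₄ ih =>
    intro Δ Θ m₃
    obtain ⟨Ξ, m₁, m₂, h⟩ := ih m₃
    have hx' : x ∉ Ξ.vars := fun hh => hx ((m₂.mem_vars x).2 (.inl hh))
    refine ⟨_, .left x τ hx' m₁, .left x τ hx m₂, ?_⟩
    simp only [merge_left, env, comp_whiskerRight, Category.assoc,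
      reassoc_of% @swapLast_natural_left, swapLast_swapLast_associator, swapLast_natural_middle]
    simp only [← comp_whiskerRight_assoc, h]
  | @right Γ Ξ' Ω x τ hx m₄ ih =>
    intro Δ Θ m₃
    cases m₃ with
    | @left Δ _ _ _ _ hx₃ m₃ =>
      obtain ⟨Ξ, m₁, m₂, h⟩ := ih m₃
      have hx' : x ∉ Ξ.vars := fun hh => hx ((m₂.mem_vars x).2 (.inl hh))
      refine ⟨_, .right x τ hx' m₁, .left x τ hx m₂, ?_⟩
      simp only [merge_left, merge_right, env, comp_whiskerRight, Category.assoc,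
        reassoc_of% @swapLast_natural_left, swapLast_associator, MonoidalCategory.whiskerLeft_comp,
        ← associator_naturality_middle_assoc]
      simp only [← comp_whiskerRight_assoc, h]
    | @right _ Θ _ _ _ hx₃ m₃ =>
      obtain ⟨Ξ, m₁, m₂, h⟩ := ih m₃
      refine ⟨_, m₁, .right x τ hx m₂, ?_⟩
      simp only [merge_right, env, Category.assoc, MonoidalCategory.whiskerLeft_comp,
        ← associator_naturality_middle_assoc, ← associator_naturality_left_assoc]
      rw [← comp_whiskerRight_assoc, ← comp_whiskerRight_assoc, ← h]
      simp only [Category.assoc, comp_whiskerRight, pentagon]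

/-- Reassociate to Γ # (Δ # Θ), exchange the two inner parts, and reassociate back. -/
theorem merge_right_comm {Γ Δ Θ Ξ Ω : Env} (m₁ : Merge Γ Δ Ξ) (m₂ : Merge Ξ Θ Ω) :
    ∃ (Ξ' : Env) (m₃ : Merge Γ Θ Ξ') (m₄ : Merge Ξ' Δ Ω),
      P.merge m₂ ≫ P.merge m₁ ▷ P.env Θ ≫ swapLast _ _ _ =
        P.merge m₄ ≫ P.merge m₃ ▷ P.env Δ := by
  obtain ⟨_, n₁, n₂, h⟩ := P.merge_assoc m₂ m₁
  obtain ⟨Ξ', m₃, m₄, h'⟩ := P.merge_assoc_inv n₂ n₁.symm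
  refine ⟨Ξ', m₃, m₄, ?_⟩
  rw [← cancel_mono (α_ _ _ _).hom, Category.assoc, Category.assoc, Category.assoc, h',
    merge_symm, MonoidalCategory.whiskerLeft_comp, ← reassoc_of% h]
  simp [swapLast]

end PreModel

/-! ### Currying -/

section Curry

variable {C : Type u} [Category.{v} C] [MonoidalCategory C] [SymmetricCategory C]
  [MonoidalClosed C]

theorem rcurry_reval {X Y Z : C} (g : X ⊗ Y ⟶ Z) : rcurry g ▷ Y ≫ reval Y Z = g := by
  rw [reval, BraidedCategory.braiding_naturality_left_assoc, rcurry,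
    ← MonoidalClosed.uncurry_eq, MonoidalClosed.uncurry_curry, SymmetricCategory.symmetry_assoc]

theorem comp_rcurry {W X Y Z : C} (f : W ⟶ X) (g : X ⊗ Y ⟶ Z) :
    f ≫ rcurry g = rcurry (f ▷ Y ≫ g) := by
  rw [rcurry, rcurry, ← MonoidalClosed.curry_natural_left,
    BraidedCategory.braiding_naturality_right_assoc]

theorem rcurry_whiskerRight_reval {X Y Z : C} (g : X ⟶ (ihom Y).obj Z) :
    rcurry (g ▷ Y ≫ reval Y Z) = g := by
  rw [rcurry, reval, BraidedCategory.braiding_naturality_left_assoc,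
    SymmetricCategory.symmetry_assoc, ← MonoidalClosed.uncurry_eq, MonoidalClosed.curry_uncurry]

theorem rcurry_associator_whiskerRight {A A' X Y Z : C} (a : A ⟶ A') (g : A' ⊗ X ⊗ Y ⟶ Z) :
    rcurry ((α_ _ _ _).hom ≫ a ▷ (X ⊗ Y) ≫ g) = a ▷ X ≫ rcurry ((α_ _ _ _).hom ≫ g) := by
  rw [comp_rcurry, associator_naturality_left_assoc]

end Curry

namespace PreModel

variable {C : Type u} [Category.{v} C] [MonoidalCategory C] [SymmetricCategory C]
  [MonoidalClosed C] {S : Set FunSym} (P : PreModel C S)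

/-! ### The interpretation as a relation -/

/-- `Γ ⊢ M : τ` holds and its interpretation is `g`. -/
def Den (Γ : Env) (M : Tm S) (τ : Ty) (g : P.env Γ ⟶ P.ty τ) : Prop :=
  ∃ D : Deriv Γ M τ, P.interp D = g

variable {P} in
theorem Den.typed {Γ : Env} {M : Tm S} {τ : Ty} {g : P.env Γ ⟶ P.ty τ} (h : P.Den Γ M τ g) :
    Typed Γ M τ := ⟨h.choose⟩

theorem den_den {Γ : Env} {M : Tm S} {τ : Ty} (h : Typed Γ M τ) : P.Den Γ M τ (P.den h) :=
  ⟨h.some, rfl⟩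

variable {P} in
theorem Den.den_eq {Γ : Env} {M : Tm S} {τ : Ty} {g : P.env Γ ⟶ P.ty τ} (h : P.Den Γ M τ g)
    (h' : Typed Γ M τ) : P.den h' = g := by
  obtain ⟨D, rfl⟩ := h
  rw [den, Subsingleton.elim h'.some D]

variable {P} in
theorem Den.eq {Γ : Env} {M : Tm S} {τ : Ty} {g g' : P.env Γ ⟶ P.ty τ} (h : P.Den Γ M τ g)
    (h' : P.Den Γ M τ g') : g = g' := by
  rw [← h.den_eq h.typed, ← h'.den_eq h.typed]

variable {P} in
theorem Den.nodup {Γ : Env} {M : Tm S} {τ : Ty} {g : P.env Γ ⟶ P.ty τ} (h : P.Den Γ M τ g) :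
    Γ.vars.Nodup := h.choose.nodup

variable {P} in
theorem Den.mem_vars {Γ : Env} {M : Tm S} {τ : Ty} {g : P.env Γ ⟶ P.ty τ} (h : P.Den Γ M τ g)
    (z : Var) : z ∈ Γ.vars ↔ z ∈ M.fv := h.choose.mem_vars z

theorem den_var (x : Var) (τ : Ty) : P.Den [(x, τ)] (.var x) τ (λ_ (P.ty τ)).hom :=
  ⟨.var x τ, by simp only [interp]; rfl⟩

theorem den_num (a : ℝ) : P.Den [] (.num a) .R (P.num a) := ⟨.num a, by simp only [interp]; rfl⟩

theorem den_star : P.Den [] .star .I (𝟙 (𝟙_ C)) := ⟨.star, by simp only [interp]; rfl⟩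

theorem den_lam {Γ : Env} {x : Var} {σ τ : Ty} {M : Tm S} {g : P.env Γ ⊗ P.ty σ ⟶ P.ty τ}
    (h : P.Den ((x, σ) :: Γ) M τ g) : P.Den Γ (.lam x σ M) (.lolli σ τ) (rcurry g) := by
  obtain ⟨D, rfl⟩ := h
  exact ⟨.lam D, by simp only [interp]; rfl⟩

theorem den_app {Γ Δ Ξ : Env} {σ τ : Ty} {M N : Tm S} {g₁ : P.env Γ ⟶ P.ty (.lolli σ τ)}
    {g₂ : P.env Δ ⟶ P.ty σ} (m : Merge Γ Δ Ξ) (h₁ : P.Den Γ M (.lolli σ τ) g₁)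
    (h₂ : P.Den Δ N σ g₂) :
    P.Den Ξ (.app M N) τ (P.merge m ≫ (g₁ ⊗ₘ g₂) ≫ reval (P.ty σ) (P.ty τ)) := by
  obtain ⟨D₁, rfl⟩ := h₁
  obtain ⟨D₂, rfl⟩ := h₂
  exact ⟨.app D₁ D₂ m, by simp only [interp]⟩

theorem den_tensor {Γ Δ Ξ : Env} {σ τ : Ty} {M N : Tm S} {g₁ : P.env Γ ⟶ P.ty τ}
    {g₂ : P.env Δ ⟶ P.ty σ} (m : Merge Γ Δ Ξ) (h₁ : P.Den Γ M τ g₁) (h₂ : P.Den Δ N σ g₂) :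
    P.Den Ξ (.tensor M N) (.tensor τ σ) (P.merge m ≫ (g₁ ⊗ₘ g₂)) := by
  obtain ⟨D₁, rfl⟩ := h₁
  obtain ⟨D₂, rfl⟩ := h₂
  exact ⟨.tensor D₁ D₂ m, by simp only [interp]⟩

theorem den_letStar {Γ Δ Ξ : Env} {τ : Ty} {M N : Tm S} {g₁ : P.env Γ ⟶ 𝟙_ C}
    {g₂ : P.env Δ ⟶ P.ty τ} (m : Merge Γ Δ Ξ) (h₁ : P.Den Γ M .I g₁) (h₂ : P.Den Δ N τ g₂) :
    P.Den Ξ (.letStar M N) τ (P.merge m ≫ (g₁ ⊗ₘ g₂) ≫ (λ_ (P.ty τ)).hom) := by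
  obtain ⟨D₁, rfl⟩ := h₁
  obtain ⟨D₂, rfl⟩ := h₂
  exact ⟨.letStar D₁ D₂ m, by simp only [interp]; rfl⟩

theorem den_letPair {Γ Δ Ξ : Env} {x y : Var} {σ₁ σ₂ τ : Ty} {M N : Tm S}
    {g₁ : P.env Γ ⟶ P.ty σ₁ ⊗ P.ty σ₂} {g₂ : (P.env Δ ⊗ P.ty σ₁) ⊗ P.ty σ₂ ⟶ P.ty τ}
    (m : Merge Γ Δ Ξ) (h₁ : P.Den Γ M (.tensor σ₁ σ₂) g₁)
    (h₂ : P.Den ((y, σ₂) :: (x, σ₁) :: Δ) N τ g₂) :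
    P.Den Ξ (.letPair x y M N) τ (P.merge m ≫ g₁ ▷ P.env Δ ≫
      (β_ (P.ty σ₁ ⊗ P.ty σ₂) (P.env Δ)).hom ≫ (α_ (P.env Δ) (P.ty σ₁) (P.ty σ₂)).inv ≫ g₂) := by
  obtain ⟨D₁, rfl⟩ := h₁
  obtain ⟨D₂, rfl⟩ := h₂
  exact ⟨.letPair D₁ D₂ m, by simp only [interp]; rfl⟩

/-- The arguments `M₁, …, Mₙ₊₁` are typed as reals in environments with merge `Ξ`, and the tensor
product of their interpretations, precomposed with the rearrangement of factors, is `g`. -/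
def DenArgs : (n : ℕ) → (Fin (n + 1) → Tm S) → (Ξ : Env) →
    (P.env Ξ ⟶ tens n fun _ => P.real) → Prop
  | 0, Ms, Ξ, g => P.Den Ξ (Ms 0) .R g
  | n + 1, Ms, Ξ, g => ∃ (Γ Δ : Env) (m : Merge Γ Δ Ξ) (g₁ : P.env Γ ⟶ tens n fun _ => P.real)
      (g₂ : P.env Δ ⟶ P.real), DenArgs n (fun i => Ms i.castSucc) Γ g₁ ∧
        P.Den Δ (Ms (Fin.last (n + 1))) .R g₂ ∧ g = P.merge m ≫ (g₁ ⊗ₘ g₂)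

theorem merge_whiskerRight_tensorHom {Γ Δ Ξ : Env} (m : Merge Γ Δ Ξ) {X Y Z : C}
    (a : P.env Γ ⟶ X) (b : X ⟶ Y) (c : P.env Δ ⟶ Z) :
    (P.merge m ≫ a ▷ P.env Δ) ≫ (b ⊗ₘ c) = P.merge m ≫ ((a ≫ b) ⊗ₘ c) := by
  simp [← tensorHom_id]

/-- Together with its converse `DenArgs.exists_mergeN`, this reduces function symbols of any arity
to binary merges, by induction on the arity. -/
theorem denArgs_of_mergeN {n : ℕ} {Γs : Fin (n + 1) → Env} {Ξ : Env} (m : MergeN Γs Ξ) :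
    ∀ {Ms : Fin (n + 1) → Tm S} (D : ∀ i, Deriv (Γs i) (Ms i) .R),
    P.DenArgs n Ms Ξ (P.mergeN m ≫ tensHom n (fun i => P.interp (D i))) := by
  induction m with
  | single Γs =>
    intro Ms D
    exact ⟨D 0, by simp only [mergeN, tensHom]; exact (Category.id_comp _).symm⟩
  | snoc Γs m₁ m₂ ih =>
    intro Ms D
    refine ⟨_, _, m₂, _, _, ih (fun i => D i.castSucc), ⟨D (Fin.last _), rfl⟩, ?_⟩
    simp only [mergeN, tensHom]
    exact P.merge_whiskerRight_tensorHom _ _ _ _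

theorem DenArgs.exists_mergeN : ∀ {n : ℕ} {Ms : Fin (n + 1) → Tm S} {Ξ : Env}
    {g : P.env Ξ ⟶ tens n fun _ => P.real}, P.DenArgs n Ms Ξ g →
    ∃ (Γs : Fin (n + 1) → Env) (m : MergeN Γs Ξ) (D : ∀ i, Deriv (Γs i) (Ms i) .R),
      P.mergeN m ≫ tensHom n (fun i => P.interp (D i)) = g
  | 0, Ms, Ξ, g, ⟨D, h⟩ =>
    ⟨fun _ => Ξ, .single _, fun i => Fin.cases D (fun j => j.elim0) i, by
      simp only [mergeN, tensHom, ← h]; exact Category.id_comp _⟩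
  | n + 1, Ms, Ξ, g, ⟨Γ, Δ, m, g₁, g₂, h₁, ⟨D₂, h₂⟩, h⟩ => by
    obtain ⟨Γs, m₁, D₁, h₁⟩ := exists_mergeN h₁
    -- `Fin.snoc` is replaced by a function known only through its two restrictions, so that both
    -- equations can be eliminated in the dependent data.
    obtain ⟨Γs', rfl, rfl⟩ : ∃ Γs' : Fin (n + 1 + 1) → Env,
        (fun i => Γs' i.castSucc) = Γs ∧ Γs' (Fin.last _) = Δ :=
      ⟨Fin.snoc Γs Δ, by simp, by simp⟩
    refine ⟨Γs', .snoc Γs' m₁ m, Fin.lastCases D₂ D₁, ?_⟩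
    subst h h₁ h₂
    simp only [mergeN, tensHom, Fin.lastCases_castSucc, Fin.lastCases_last]
    exact P.merge_whiskerRight_tensorHom _ _ _ _

theorem interp_fn (f : S) {Γs : Fin (f.1.n + 1) → Env} {Ms : Fin (f.1.n + 1) → Tm S} {Ξ : Env}
    (D : ∀ i, Deriv (Γs i) (Ms i) .R) (m : MergeN Γs Ξ) :
    P.interp (.fn f D m) = (P.mergeN m ≫ tensHom f.1.n (fun i => P.interp (D i))) ≫ P.fn f := by
  simp only [interp]
  exact (Category.assoc _ _ _).symm

theorem den_fn {f : S} {Ms : Fin (f.1.n + 1) → Tm S} {Ξ : Env}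
    {g : P.env Ξ ⟶ tens f.1.n fun _ => P.real} (h : P.DenArgs f.1.n Ms Ξ g) :
    P.Den Ξ (.fn f Ms) .R (g ≫ P.fn f) := by
  obtain ⟨Γs, m, D, rfl⟩ := DenArgs.exists_mergeN P h
  exact ⟨.fn f D m, P.interp_fn f D m⟩

end PreModel

/-! ### Free variables and substitution -/

theorem pick_notMem (x : Var) (A : Finset Var) : pick x A ∉ A := by
  unfold pick
  split_ifs with h
  · intro h'
    exact absurd (Finset.le_sup (f := id) h') (Nat.not_succ_le_self _)
  · exact h

theorem pick_of_notMem {x : Var} {A : Finset Var} (h : x ∉ A) : pick x A = x := if_neg h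

/-- This is a literal equality, not one up to renaming: no binder is renamed because its variable is
never in the set to avoid. Typing is needed for `let x ⊗ y`, where `x = y` would force a renaming.
-/
theorem Deriv.subst_var {S : Set FunSym} {Γ : Env} {M : Tm S} {τ : Ty} (D : Deriv Γ M τ) :
    M.subst Tm.var = M := by
  induction D with
  | var | num | star => rfl
  | fn f Ds m ih => simp only [Tm.subst, ih]
  | app _ _ _ ih₁ ih₂ | tensor _ _ _ ih₁ ih₂ | letStar _ _ _ ih₁ ih₂ =>
    simp only [Tm.subst, ih₁, ih₂]
  | @lam _ x _ _ M D ih =>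
    have h : pick x ((M.fv.erase x).biUnion fun w => (Tm.var w : Tm S).fv) = x :=
      pick_of_notMem (by simp [Tm.fv])
    simp only [Tm.subst, h, Function.update_eq_self, ih]
  | @letPair _ _ _ x y _ _ _ _ N _ D₂ _ ih₁ ih₂ =>
    have hxy : y ≠ x := fun h => (Env.nodup_cons.1 D₂.nodup).1 (h ▸ List.mem_cons_self)
    have h : pick x (((N.fv.erase x).erase y).biUnion fun w => (Tm.var w : Tm S).fv) = x :=
      pick_of_notMem (by simp [Tm.fv])
    have h' : pick y (insert x
        (((N.fv.erase x).erase y).biUnion fun w => (Tm.var w : Tm S).fv)) = y :=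
      pick_of_notMem (by simp [Tm.fv, hxy])
    simp only [Tm.subst, h, h', Function.update_eq_self, ih₁, ih₂]

/-! ### Identities between tensor products of morphisms -/

section Tensor

variable {C : Type u} [Category.{v} C] [MonoidalCategory C]

theorem rightUnitor_inv_associator_tensorHom {X Y : C} (s : X ⟶ Y) (Z : C) :
    ((ρ_ X).inv ▷ Z ≫ (α_ X (𝟙_ C) Z).hom) ≫ (s ⊗ₘ (λ_ Z).hom) = s ▷ Z := by
  simp [MonoidalCategory.tensorHom_def]

/-- The inductive step of `Sub.split` for a head variable of the right part: `e` splits the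
substitution on the remaining variables and `e'` regroups the environments. `tensorHom_split_left`
does the same for the left part. -/
theorem tensorHom_split_right {X X₁ X₂ Y Z W₁ W₂ W V T : C} {n : X ⟶ Y ⊗ Z} {s : Y ⟶ W}
    {g : Z ⟶ V} {m : W ⟶ W₁ ⊗ W₂} {m' : Y ⟶ X₁ ⊗ X₂} {s₁ : X₁ ⟶ W₁} {s₂ : X₂ ⟶ W₂}
    {n₁ : T ⟶ X₂ ⊗ Z} {n₂ : X ⟶ X₁ ⊗ T} (e : s ≫ m = m' ≫ (s₁ ⊗ₘ s₂))
    (e' : n ≫ m' ▷ Z ≫ (α_ _ _ _).hom = n₂ ≫ X₁ ◁ n₁) :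
    (n ≫ (s ⊗ₘ g)) ≫ m ▷ V ≫ (α_ _ _ _).hom = n₂ ≫ (s₁ ⊗ₘ n₁ ≫ (s₂ ⊗ₘ g)) := by
  have h₁ : (s ⊗ₘ g) ≫ m ▷ V = m' ▷ Z ≫ ((s₁ ⊗ₘ s₂) ⊗ₘ g) := by
    rw [← tensorHom_id, ← tensorHom_id, tensorHom_comp_tensorHom, tensorHom_comp_tensorHom, e]
    simp
  have h₂ : (s₁ ⊗ₘ n₁ ≫ (s₂ ⊗ₘ g)) = X₁ ◁ n₁ ≫ (s₁ ⊗ₘ s₂ ⊗ₘ g) := by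
    rw [← id_tensorHom, tensorHom_comp_tensorHom, Category.id_comp]
  rw [h₂, ← reassoc_of% e', ← associator_naturality, Category.assoc, reassoc_of% h₁]

theorem tensorHom_split_left [SymmetricCategory C] {X X₁ X₂ Y Z W₁ W₂ W V T : C} {n : X ⟶ Y ⊗ Z}
    {s : Y ⟶ W} {g : Z ⟶ V} {m : W ⟶ W₁ ⊗ W₂} {m' : Y ⟶ X₁ ⊗ X₂} {s₁ : X₁ ⟶ W₁} {s₂ : X₂ ⟶ W₂}
    {n₁ : T ⟶ X₁ ⊗ Z} {n₂ : X ⟶ T ⊗ X₂} (e : s ≫ m = m' ≫ (s₁ ⊗ₘ s₂))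
    (e' : n ≫ m' ▷ Z ≫ swapLast _ _ _ = n₂ ≫ n₁ ▷ X₂) :
    (n ≫ (s ⊗ₘ g)) ≫ m ▷ V ≫ swapLast _ _ _ = n₂ ≫ (n₁ ≫ (s₁ ⊗ₘ g) ⊗ₘ s₂) := by
  have h₁ : (s ⊗ₘ g) ≫ m ▷ V = m' ▷ Z ≫ ((s₁ ⊗ₘ s₂) ⊗ₘ g) := by
    rw [← tensorHom_id, ← tensorHom_id, tensorHom_comp_tensorHom, tensorHom_comp_tensorHom, e]
    simp
  have h₂ : (n₁ ≫ (s₁ ⊗ₘ g) ⊗ₘ s₂) = n₁ ▷ X₂ ≫ ((s₁ ⊗ₘ g) ⊗ₘ s₂) := by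
    rw [← tensorHom_id, tensorHom_comp_tensorHom, Category.id_comp]
  have h₃ : ((s₁ ⊗ₘ s₂) ⊗ₘ g) ≫ swapLast _ _ _ = swapLast _ _ _ ≫ ((s₁ ⊗ₘ g) ⊗ₘ s₂) := by
    rw [swapLast, swapLast, associator_naturality_assoc, Category.assoc, Category.assoc,
      ← associator_inv_naturality, ← id_tensorHom, ← id_tensorHom, tensorHom_comp_tensorHom_assoc,
      tensorHom_comp_tensorHom_assoc, BraidedCategory.braiding_naturality]
    simp
  rw [h₂, ← reassoc_of% e', ← h₃, Category.assoc, reassoc_of% h₁]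

/-- This and the next two lemmas are the categorical content of `Den.subst` at the binary
constructors: a substitution `s` that splits as `e` passes through the merge to the two subterms. -/
theorem comp_merge_tensorHom {X Y Y₁ Y₂ X₁ X₂ Z₁ Z₂ : C} {s : X ⟶ Y} {m : Y ⟶ Y₁ ⊗ Y₂}
    {m' : X ⟶ X₁ ⊗ X₂} {s₁ : X₁ ⟶ Y₁} {s₂ : X₂ ⟶ Y₂} (e : s ≫ m = m' ≫ (s₁ ⊗ₘ s₂))
    (g₁ : Y₁ ⟶ Z₁) (g₂ : Y₂ ⟶ Z₂) :
    m' ≫ (s₁ ≫ g₁ ⊗ₘ s₂ ≫ g₂) = s ≫ m ≫ (g₁ ⊗ₘ g₂) := by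
  rw [← tensorHom_comp_tensorHom, reassoc_of% e]

theorem comp_merge_tensorHom_comp {X Y Y₁ Y₂ X₁ X₂ Z₁ Z₂ W : C} {s : X ⟶ Y} {m : Y ⟶ Y₁ ⊗ Y₂}
    {m' : X ⟶ X₁ ⊗ X₂} {s₁ : X₁ ⟶ Y₁} {s₂ : X₂ ⟶ Y₂} (e : s ≫ m = m' ≫ (s₁ ⊗ₘ s₂))
    (g₁ : Y₁ ⟶ Z₁) (g₂ : Y₂ ⟶ Z₂) (k : Z₁ ⊗ Z₂ ⟶ W) :
    m' ≫ (s₁ ≫ g₁ ⊗ₘ s₂ ≫ g₂) ≫ k = s ≫ m ≫ (g₁ ⊗ₘ g₂) ≫ k := by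
  rw [← tensorHom_comp_tensorHom, Category.assoc, reassoc_of% e]

theorem comp_merge_letPair [SymmetricCategory C] {X Y Y₁ Y₂ X₁ X₂ Z₁ Z₂ W : C} {s : X ⟶ Y}
    {m : Y ⟶ Y₁ ⊗ Y₂} {m' : X ⟶ X₁ ⊗ X₂} {s₁ : X₁ ⟶ Y₁} {s₂ : X₂ ⟶ Y₂}
    (e : s ≫ m = m' ≫ (s₁ ⊗ₘ s₂)) (g₁ : Y₁ ⟶ Z₁ ⊗ Z₂) (g₂ : (Y₂ ⊗ Z₁) ⊗ Z₂ ⟶ W) :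
    m' ≫ (s₁ ≫ g₁) ▷ X₂ ≫ (β_ _ _).hom ≫ (α_ _ _ _).inv ≫ s₂ ▷ Z₁ ▷ Z₂ ≫ g₂ =
      s ≫ m ≫ g₁ ▷ Y₂ ≫ (β_ _ _).hom ≫ (α_ _ _ _).inv ≫ g₂ := by
  rw [reassoc_of% e, ← associator_inv_naturality_left_assoc,
    ← BraidedCategory.braiding_naturality_right_assoc]
  simp [MonoidalCategory.tensorHom_def, whisker_exchange_assoc]

end Tensor

/-! ### The substitution lemma -/

namespace PreModel

variable {C : Type u} [Category.{v} C] [MonoidalCategory C] [SymmetricCategory C]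
  [MonoidalClosed C] {S : Set FunSym} (P : PreModel C S)

/-- `Sub ρ Γ Ω s`: for every `x : σ` of `Γ` the term `ρ x` has type `σ` in an environment `Δ_x`, the
environment `Ω` is a merge of the `Δ_x`, and `s` is the tensor product of the interpretations of the
`ρ x` precomposed with the rearrangement of factors. -/
inductive Sub (ρ : Var → Tm S) : (Γ Ω : Env) → (P.env Ω ⟶ P.env Γ) → Prop
  | nil : Sub ρ [] [] (𝟙 (𝟙_ C))
  | cons {Γ Ω Δ Ω' : Env} {x : Var} {σ : Ty} {s : P.env Ω ⟶ P.env Γ} {g : P.env Δ ⟶ P.ty σ}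
      (h : Sub ρ Γ Ω s) (hx : P.Den Δ (ρ x) σ g) (m : Merge Ω Δ Ω') :
      Sub ρ ((x, σ) :: Γ) Ω' (P.merge m ≫ (s ⊗ₘ g))

variable {P}

theorem Sub.nodup {ρ : Var → Tm S} {Γ Ω : Env} {s : P.env Ω ⟶ P.env Γ} (h : P.Sub ρ Γ Ω s) :
    Ω.vars.Nodup := by
  cases h with
  | nil => simp [Env.vars]
  | cons _ _ m => exact m.nodup

theorem Sub.mem_vars {ρ : Var → Tm S} {Γ Ω : Env} {s : P.env Ω ⟶ P.env Γ} (h : P.Sub ρ Γ Ω s)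
    (z : Var) : z ∈ Ω.vars ↔ ∃ w ∈ Γ.vars, z ∈ (ρ w).fv := by
  induction h with
  | nil => simp [Env.vars]
  | @cons Γ _ _ _ x σ _ _ h hx m ih =>
    have : Env.vars ((x, σ) :: Γ) = x :: Γ.vars := rfl
    simp [this, m.mem_vars, ih, hx.mem_vars, or_comm]

theorem Sub.congr {ρ ρ' : Var → Tm S} {Γ Ω : Env} {s : P.env Ω ⟶ P.env Γ} (h : P.Sub ρ Γ Ω s)
    (hρ : ∀ w ∈ Γ.vars, ρ w = ρ' w) : P.Sub ρ' Γ Ω s := by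
  induction h with
  | nil => exact .nil
  | cons h hx m ih =>
    refine .cons (ih fun w hw => hρ w (List.mem_cons_of_mem _ hw)) ?_ m
    rwa [← hρ _ List.mem_cons_self]

theorem Sub.congr_hom {ρ : Var → Tm S} {Γ Ω : Env} {s s' : P.env Ω ⟶ P.env Γ}
    (h : P.Sub ρ Γ Ω s) (hs : s = s') : P.Sub ρ Γ Ω s' := hs ▸ h

theorem Den.congr_hom {Γ : Env} {M : Tm S} {τ : Ty} {g g' : P.env Γ ⟶ P.ty τ}
    (h : P.Den Γ M τ g) (hg : g = g') : P.Den Γ M τ g' := hg ▸ h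

/-- A substitution extended by the renaming of one more variable. -/
theorem Sub.bind {ρ : Var → Tm S} {Γ Ω : Env} {s : P.env Ω ⟶ P.env Γ} (h : P.Sub ρ Γ Ω s)
    {x x' : Var} (σ : Ty) (hx : x ∉ Γ.vars) (hx' : x' ∉ Ω.vars) :
    P.Sub (Function.update ρ x (.var x')) ((x, σ) :: Γ) ((x', σ) :: Ω) (s ▷ P.ty σ) := by
  have h₁ : P.Sub (Function.update ρ x (.var x')) Γ Ω s :=
    h.congr fun w hw => (Function.update_of_ne (fun e => hx (by rwa [← e])) _ _).symm
  refine (h₁.cons (x := x) (g := (λ_ (P.ty σ)).hom) ?_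
    (.right x' σ hx' (Merge.nilLeft Ω h.nodup).symm)).congr_hom ?_
  · rw [Function.update_self]
    exact P.den_var x' σ
  · rw [merge_right, merge_nilLeft_symm]
    exact rightUnitor_inv_associator_tensorHom s _

theorem Sub.id : ∀ {Γ : Env}, Γ.vars.Nodup → P.Sub Tm.var Γ Γ (𝟙 _)
  | [], _ => .nil
  | (x, σ) :: Γ, h => by
    have hx := (Env.nodup_cons.1 h).1
    have := (Sub.id (Env.nodup_cons.1 h).2).bind σ hx hx
    rw [Function.update_eq_self] at this
    exact this.congr_hom (id_whiskerRight _ _)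

/-- Each variable of `Γ` takes the environment of its substituted term with it to one of the two
sides. Adding the head variable regroups environments by `merge_right_comm` if it goes left and by
`merge_assoc` if it goes right. -/
theorem Sub.split {ρ : Var → Tm S} {Γ₁ Γ₂ Γ : Env} (m : Merge Γ₁ Γ₂ Γ) :
    ∀ {Ω : Env} {s : P.env Ω ⟶ P.env Γ}, P.Sub ρ Γ Ω s →
    ∃ (Ω₁ Ω₂ : Env) (s₁ : P.env Ω₁ ⟶ P.env Γ₁) (s₂ : P.env Ω₂ ⟶ P.env Γ₂) (m' : Merge Ω₁ Ω₂ Ω),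
      P.Sub ρ Γ₁ Ω₁ s₁ ∧ P.Sub ρ Γ₂ Ω₂ s₂ ∧ s ≫ P.merge m = P.merge m' ≫ (s₁ ⊗ₘ s₂) := by
  induction m with
  | nil =>
    intro Ω s h
    cases h
    exact ⟨_, _, _, _, .nil, .nil, .nil, by
      change 𝟙 _ ≫ (λ_ (𝟙_ C)).inv = (λ_ (𝟙_ C)).inv ≫ (𝟙 _ ⊗ₘ 𝟙 _)
      simp⟩
  | left x τ hx m ih =>
    intro Ω s h
    cases h with
    | @cons _ _ _ _ _ _ s g h hg n =>
      obtain ⟨Ω₁, Ω₂, s₁, s₂, m', h₁, h₂, e⟩ := ih h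
      obtain ⟨Ω₁', n₁, n₂, e'⟩ := P.merge_right_comm m' n
      refine ⟨_, _, _, _, n₂, h₁.cons hg n₁, h₂, ?_⟩
      rw [merge_left]
      exact tensorHom_split_left e e'
  | right x τ hx m ih =>
    intro Ω s h
    cases h with
    | @cons _ _ _ _ _ _ s g h hg n =>
      obtain ⟨Ω₁, Ω₂, s₁, s₂, m', h₁, h₂, e⟩ := ih h
      obtain ⟨Ω₂', n₁, n₂, e'⟩ := P.merge_assoc n m'
      refine ⟨_, _, _, _, n₂, h₁, h₂.cons hg n₁, ?_⟩
      rw [merge_right]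
      exact tensorHom_split_right e e'

theorem Sub.single {ρ : Var → Tm S} {x : Var} {σ : Ty} {Ω : Env} {s : P.env Ω ⟶ 𝟙_ C ⊗ P.ty σ}
    (h : P.Sub ρ [(x, σ)] Ω s) : P.Den Ω (ρ x) σ (s ≫ (λ_ _).hom) := by
  cases h with
  | @cons _ _ _ _ _ _ s g h hg n =>
    cases h
    -- A merge with the empty environment is unique, so its isomorphism is an inverse unitor.
    obtain ⟨-, rfl, e⟩ := n.unique (Merge.nilLeft Ω n.nodup) fun _ => Iff.rfl
    refine hg.congr_hom ?_
    rw [eq_of_heq e, merge_nilLeft]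
    change g = ((λ_ _).inv ≫ (𝟙 (𝟙_ C) ⊗ₘ g)) ≫ (λ_ _).hom
    simp

theorem DenArgs.subst {ρ : Var → Tm S} : ∀ {n : ℕ} {Ms : Fin (n + 1) → Tm S} {Γ Ω : Env}
    {g : P.env Γ ⟶ tens n fun _ => P.real} {s : P.env Ω ⟶ P.env Γ}
    (_ : ∀ (i : Fin (n + 1)) {Γ Ω : Env} {g : P.env Γ ⟶ P.ty .R} {s : P.env Ω ⟶ P.env Γ},
      P.Den Γ (Ms i) .R g → P.Sub ρ Γ Ω s → P.Den Ω ((Ms i).subst ρ) .R (s ≫ g)),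
    P.DenArgs n Ms Γ g → P.Sub ρ Γ Ω s → P.DenArgs n (fun i => (Ms i).subst ρ) Ω (s ≫ g)
  | 0, _, _, _, _, _, H, h, hs => H 0 h hs
  | n + 1, Ms, Γ, Ω, g, s, H, h, hs => by
    obtain ⟨Γ₁, Γ₂, m, g₁, g₂, h₁, h₂, rfl⟩ := h
    obtain ⟨Ω₁, Ω₂, s₁, s₂, m', hs₁, hs₂, e⟩ := hs.split m
    exact ⟨Ω₁, Ω₂, m', _, _, DenArgs.subst (fun i => H i.castSucc) h₁ hs₁, H _ h₂ hs₂,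
      (comp_merge_tensorHom e g₁ g₂).symm⟩

/-- The interpretation of a substitution instance. -/
theorem Den.subst {M : Tm S} : ∀ {Γ Ω : Env} {τ : Ty} {ρ : Var → Tm S} {g : P.env Γ ⟶ P.ty τ}
    {s : P.env Ω ⟶ P.env Γ}, P.Den Γ M τ g → P.Sub ρ Γ Ω s → P.Den Ω (M.subst ρ) τ (s ≫ g) := by
  induction M with
  | var x =>
    rintro Γ Ω τ ρ g s ⟨D, rfl⟩ hs
    cases D
    simp only [interp]
    exact hs.single
  | num a =>
    rintro Γ Ω τ ρ g s ⟨D, rfl⟩ hs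
    cases D
    cases hs
    exact (P.den_num a).congr_hom (by simp only [interp]; exact (Category.id_comp _).symm)
  | star =>
    rintro Γ Ω τ ρ g s ⟨D, rfl⟩ hs
    cases D
    cases hs
    exact P.den_star.congr_hom (by simp only [interp]; exact (Category.id_comp _).symm)
  | fn f Ms ih =>
    rintro Γ Ω τ ρ g s ⟨D, rfl⟩ hs
    cases D with
    | fn _ D m =>
      exact (P.den_fn (DenArgs.subst (fun i => ih i) (P.denArgs_of_mergeN m D) hs)).congr_hom
        (by rw [interp_fn]; exact Category.assoc _ _ _)
  | app M N ih₁ ih₂ =>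
    rintro Γ Ω τ ρ g s ⟨D, rfl⟩ hs
    cases D with
    | app D₁ D₂ m =>
      obtain ⟨Ω₁, Ω₂, s₁, s₂, m', hs₁, hs₂, e⟩ := hs.split m
      refine (P.den_app m' (ih₁ ⟨D₁, rfl⟩ hs₁) (ih₂ ⟨D₂, rfl⟩ hs₂)).congr_hom ?_
      simp only [interp]
      exact comp_merge_tensorHom_comp e _ _ _
  | lam x τ M ih =>
    rintro Γ Ω τ ρ g s ⟨D, rfl⟩ hs
    cases D with
    | @lam _ _ σ τ _ D =>
      have hx := Env.nodup_cons.1 D.nodup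
      refine (P.den_lam (ih ⟨D, rfl⟩ (hs.bind _ hx.1 ?_))).congr_hom ?_
      -- Every variable of `Ω` is free in some `ρ w` with `w` in `Γ`, and `pick` avoids all of
      -- these; hence the new bound variable is fresh for `Ω`.
      · intro h
        obtain ⟨w, hw, hz⟩ := (hs.mem_vars _).1 h
        refine pick_notMem x _ (Finset.mem_biUnion.2 ⟨w, ?_, hz⟩)
        rw [Finset.mem_erase, ← D.mem_vars]
        exact ⟨fun e => hx.1 (e ▸ hw), List.mem_cons_of_mem _ hw⟩
      · simp only [interp]
        exact (comp_rcurry s _).symm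
  | tensor M N ih₁ ih₂ =>
    rintro Γ Ω τ ρ g s ⟨D, rfl⟩ hs
    cases D with
    | tensor D₁ D₂ m =>
      obtain ⟨Ω₁, Ω₂, s₁, s₂, m', hs₁, hs₂, e⟩ := hs.split m
      refine (P.den_tensor m' (ih₁ ⟨D₁, rfl⟩ hs₁) (ih₂ ⟨D₂, rfl⟩ hs₂)).congr_hom ?_
      simp only [interp]
      exact comp_merge_tensorHom e _ _
  | letStar M N ih₁ ih₂ =>
    rintro Γ Ω τ ρ g s ⟨D, rfl⟩ hs
    cases D with
    | letStar D₁ D₂ m =>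
      obtain ⟨Ω₁, Ω₂, s₁, s₂, m', hs₁, hs₂, e⟩ := hs.split m
      refine (P.den_letStar m' (ih₁ ⟨D₁, rfl⟩ hs₁) (ih₂ ⟨D₂, rfl⟩ hs₂)).congr_hom ?_
      simp only [interp]
      exact comp_merge_tensorHom_comp e _ _ _
  | letPair x y M N ih₁ ih₂ =>
    rintro Γ Ω τ ρ g s ⟨D, rfl⟩ hs
    cases D with
    | letPair D₁ D₂ m =>
      obtain ⟨Ω₁, Ω₂, s₁, s₂, m', hs₁, hs₂, e⟩ := hs.split m
      have hy := Env.nodup_cons.1 D₂.nodup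
      have hx := Env.nodup_cons.1 hy.2
      have hΔ : ∀ w ∈ Env.vars _, w ∈ (N.fv.erase x).erase y := fun w hw => by
        rw [Finset.mem_erase, Finset.mem_erase, ← D₂.mem_vars]
        exact ⟨fun e => hy.1 (List.mem_cons_of_mem _ (e ▸ hw)), fun e => hx.1 (e ▸ hw),
          List.mem_cons_of_mem _ (List.mem_cons_of_mem _ hw)⟩
      refine (P.den_letPair m' (ih₁ ⟨D₁, rfl⟩ hs₁) (ih₂ ⟨D₂, rfl⟩
        ((hs₂.bind _ hx.1 ?_).bind _ hy.1 ?_))).congr_hom ?_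
      · intro h
        obtain ⟨w, hw, hz⟩ := (hs₂.mem_vars _).1 h
        exact pick_notMem x _ (Finset.mem_biUnion.2 ⟨w, hΔ w hw, hz⟩)
      -- The second bound variable must also differ from the first one, which is why the avoided set
      -- contains it.
      · intro h
        refine pick_notMem y (insert
          (pick x (((N.fv.erase x).erase y).biUnion fun w => (ρ w).fv))
          (((N.fv.erase x).erase y).biUnion fun w => (ρ w).fv)) ?_
        rcases List.mem_cons.1 h with h | h
        · exact h ▸ Finset.mem_insert_self _ _
        · obtain ⟨w, hw, hz⟩ := (hs₂.mem_vars _).1 h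
          exact Finset.mem_insert_of_mem (Finset.mem_biUnion.2 ⟨w, hΔ w hw, hz⟩)
      · simp only [interp]
        exact comp_merge_letPair e _ _

end PreModel

/-! ### Exchange of variables and the β rules -/

/-- The merge of an environment with one variable, added at its head. -/
def Merge.single {Γ : Env} (x : Var) (σ : Ty) (hx : x ∉ Γ.vars) (h : Γ.vars.Nodup) :
    Merge Γ [(x, σ)] ((x, σ) :: Γ) :=
  .right x σ hx (Merge.nilLeft Γ h).symm

theorem Merge.eq_of_nil {Δ Ω : Env} (m : Merge [] Δ Ω) : Δ = Ω :=
  (m.unique (Merge.nilLeft Ω m.nodup) fun _ => Iff.rfl).2.1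

section Tensor

variable {C : Type u} [Category.{v} C] [MonoidalCategory C]

theorem rightUnitor_inv_associator (X Y : C) :
    (ρ_ X).inv ▷ Y ≫ (α_ X (𝟙_ C) Y).hom = X ◁ (λ_ Y).inv := by
  simp

theorem tensorHom_exchange {W V U Z Y : C} {m₃ : Y ⟶ W ⊗ V} {m₀ : U ⟶ W ⊗ V} [IsIso m₀] :
    (m₃ ≫ inv m₀ ⊗ₘ (λ_ Z).hom) ≫ m₀ ▷ Z = m₃ ▷ _ ≫ (W ⊗ V) ◁ (λ_ Z).hom := by
  rw [← tensorHom_id, tensorHom_comp_tensorHom, Category.assoc, IsIso.inv_hom_id,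
    Category.comp_id, Category.comp_id, MonoidalCategory.tensorHom_def]

theorem tensorHom_exchange_right {X Y Z W V U : C} {m₄ : X ⟶ Y ⊗ (𝟙_ C ⊗ Z)} {m₃ : Y ⟶ W ⊗ V}
    {m₀ : U ⟶ W ⊗ V} [IsIso m₀] {m : X ⟶ W ⊗ (V ⊗ Z)}
    (h : m₄ ≫ m₃ ▷ _ ≫ (α_ _ _ _).hom = m ≫ W ◁ V ◁ (λ_ Z).inv) :
    (m₄ ≫ (m₃ ≫ inv m₀ ⊗ₘ (λ_ Z).hom)) ≫ m₀ ▷ Z ≫ (α_ _ _ _).hom = m := by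
  rw [Category.assoc, reassoc_of% tensorHom_exchange (m₀ := m₀) (m₃ := m₃) (Z := Z),
    associator_naturality_right, reassoc_of% h, ← MonoidalCategory.whiskerLeft_comp,
    ← MonoidalCategory.whiskerLeft_comp]
  simp

variable [SymmetricCategory C]

theorem swapLast_swapLast (X Y Z : C) : swapLast X Y Z ≫ swapLast X Z Y = 𝟙 _ := by
  simp only [swapLast, Category.assoc, Iso.inv_hom_id_assoc,
    ← MonoidalCategory.whiskerLeft_comp_assoc, SymmetricCategory.symmetry]
  simp

theorem tensorHom_exchange_left {X Y Z W V U : C} {m₄ : X ⟶ Y ⊗ (𝟙_ C ⊗ Z)} {m₃ : Y ⟶ W ⊗ V}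
    {m₀ : U ⟶ W ⊗ V} [IsIso m₀] {m : X ⟶ (W ⊗ Z) ⊗ V}
    (h : m ≫ (W ◁ (λ_ Z).inv) ▷ V ≫ swapLast _ _ _ = m₄ ≫ m₃ ▷ _) :
    (m₄ ≫ (m₃ ≫ inv m₀ ⊗ₘ (λ_ Z).hom)) ≫ m₀ ▷ Z ≫ swapLast _ _ _ = m := by
  rw [Category.assoc, reassoc_of% tensorHom_exchange (m₀ := m₀) (m₃ := m₃) (Z := Z),
    ← reassoc_of% h,
    reassoc_of% @swapLast_natural_middle, swapLast_swapLast, Category.comp_id,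
    ← comp_whiskerRight, ← MonoidalCategory.whiskerLeft_comp]
  simp

theorem tensorHom_pairBeta {X Y Γ Δ₁ Δ₂ Θ Z₁ Z₂ W : C} {q : X ⟶ Θ ⊗ Δ₂} {p : Θ ⟶ Γ ⊗ Δ₁}
    {m : X ⟶ Y ⊗ Γ} {n : Y ⟶ Δ₁ ⊗ Δ₂}
    (e : q ≫ p ▷ Δ₂ ≫ (α_ _ _ _).hom = (m ≫ (β_ _ _).hom) ≫ Γ ◁ n) (g₁ : Δ₁ ⟶ Z₁) (g₂ : Δ₂ ⟶ Z₂)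
    (g : (Γ ⊗ Z₁) ⊗ Z₂ ⟶ W) :
    q ≫ p ▷ Δ₂ ≫ ((𝟙 Γ ⊗ₘ g₁) ⊗ₘ g₂) ≫ g =
      m ≫ (n ≫ (g₁ ⊗ₘ g₂)) ▷ Γ ≫ (β_ _ _).hom ≫ (α_ _ _ _).inv ≫ g := by
  have h : ((𝟙 Γ ⊗ₘ g₁) ⊗ₘ g₂) = (α_ _ _ _).hom ≫ Γ ◁ (g₁ ⊗ₘ g₂) ≫ (α_ _ _ _).inv := by
    rw [← id_tensorHom, associator_inv_naturality, Iso.hom_inv_id_assoc]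
  rw [h, Category.assoc, Category.assoc, reassoc_of% e,
    BraidedCategory.braiding_naturality_left_assoc, MonoidalCategory.whiskerLeft_comp_assoc]

theorem rcurry_tensorHom_reval [MonoidalClosed C] {X Y Z W : C} (g : X ⊗ Y ⟶ Z) (g' : W ⟶ Y) :
    (rcurry g ⊗ₘ g') ≫ reval Y Z = X ◁ g' ≫ g := by
  rw [MonoidalCategory.tensorHom_def', Category.assoc, rcurry_reval]

end Tensor

namespace PreModel

variable {C : Type u} [Category.{v} C] [MonoidalCategory C] [SymmetricCategory C]
  [MonoidalClosed C] {S : Set FunSym} {P : PreModel C S}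

theorem merge_single {Γ : Env} (x : Var) (σ : Ty) (hx : x ∉ Γ.vars) (h : Γ.vars.Nodup) :
    P.merge (Merge.single x σ hx h) = P.env Γ ◁ (λ_ (P.ty σ)).inv := by
  rw [Merge.single, merge_right, merge_nilLeft_symm]
  exact rightUnitor_inv_associator _ _

theorem merge_nil {Δ : Env} (m : Merge [] Δ Δ) : P.merge m = (λ_ (P.env Δ)).inv := by
  rw [eq_of_heq (m.unique (Merge.nilLeft Δ m.nodup) fun _ => Iff.rfl).2.2, merge_nilLeft]

/-- The exchange of variables between two merges of the same environments. -/
theorem Sub.exchange {Γ Θ Ξ : Env} (m : Merge Γ Θ Ξ) : ∀ {Ω : Env} (n : Merge Γ Θ Ω),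
    P.Sub Tm.var Ξ Ω (P.merge n ≫ inv (P.merge m)) := by
  induction m with
  | nil =>
    intro Ω n
    cases n
    exact Sub.nil.congr_hom (IsIso.hom_inv_id (P.merge .nil)).symm
  | @left Γ Θ Ξ x τ hx m ih =>
    intro Ω n
    have hΓ := Env.nodup_cons.1 n.nodup_left
    -- The head variable of `Ξ` may lie anywhere in `Ω`; it is split off as a separate right part,
    -- the form that `Sub.cons` requires.
    obtain ⟨_, m₃, m₄, h⟩ := P.merge_right_comm (Merge.single x τ hΓ.1 hΓ.2) n
    refine ((ih m₃).cons (P.den_var x τ) m₄).congr_hom ?_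
    rw [merge_single] at h
    rw [IsIso.eq_comp_inv, merge_left]
    exact tensorHom_exchange_left h
  | @right Γ Θ Ξ x τ hx m ih =>
    intro Ω n
    have hΘ := Env.nodup_cons.1 n.nodup_right
    obtain ⟨_, m₃, m₄, h⟩ := P.merge_assoc_inv n (Merge.single x τ hΘ.1 hΘ.2)
    refine ((ih m₃).cons (P.den_var x τ) m₄).congr_hom ?_
    rw [merge_single] at h
    rw [IsIso.eq_comp_inv, merge_right]
    exact tensorHom_exchange_right h

theorem Den.exchange {Γ Θ Ξ Ω : Env} {M : Tm S} {τ : Ty} {g : P.env Ξ ⟶ P.ty τ}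
    (h : P.Den Ξ M τ g) (m : Merge Γ Θ Ξ) (n : Merge Γ Θ Ω) :
    P.Den Ω M τ (P.merge n ≫ inv (P.merge m) ≫ g) := by
  have := h.subst (Sub.exchange m n)
  rw [h.choose.subst_var] at this
  exact this.congr_hom (Category.assoc _ _ _)

theorem Merge.exists_insert {x : Var} {σ : Ty} : ∀ {Ω : Env}, Ω.vars.Nodup → (x, σ) ∈ Ω →
    ∃ Ω' : Env, Nonempty (Merge Ω' [(x, σ)] Ω) ∧ Ω.Perm ((x, σ) :: Ω')
  | (y, τ) :: Ω, h, hx => by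
    have hy := Env.nodup_cons.1 h
    rcases List.mem_cons.1 hx with e | hx
    · cases e
      exact ⟨Ω, ⟨Merge.single x σ hy.1 hy.2⟩, .refl _⟩
    · obtain ⟨Ω', ⟨m⟩, p⟩ := exists_insert hy.2 hx
      exact ⟨_, ⟨.left y τ hy.1 m⟩, (p.cons _).trans (.swap _ _ _)⟩

/-- No formula for the morphism is given: its use needs only one morphism that serves for all terms
at once. -/
theorem Sub.exists_of_perm : ∀ {Γ Ω : Env}, Ω.vars.Nodup → Γ.Perm Ω →
    ∃ s : P.env Ω ⟶ P.env Γ, P.Sub Tm.var Γ Ω s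
  | [], Ω, _, p => by
    obtain rfl := p.nil_eq
    exact ⟨_, .nil⟩
  | (x, σ) :: Γ, Ω, h, p => by
    obtain ⟨Ω', ⟨m⟩, p'⟩ := Merge.exists_insert h (p.subset List.mem_cons_self)
    obtain ⟨s, hs⟩ := exists_of_perm m.nodup_left (p.trans p').cons_inv
    exact ⟨_, hs.cons (P.den_var x σ) m⟩

theorem Den.subst1 {Γ Δ Ξ : Env} {x : Var} {σ τ : Ty} {M N : Tm S}
    {g : P.env Γ ⊗ P.ty σ ⟶ P.ty τ} {g' : P.env Δ ⟶ P.ty σ} (h : P.Den ((x, σ) :: Γ) M τ g)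
    (h' : P.Den Δ N σ g') (m : Merge Γ Δ Ξ) :
    P.Den Ξ (M.subst1 x N) τ (P.merge m ≫ P.env Γ ◁ g' ≫ g) := by
  have hx := Env.nodup_cons.1 h.nodup
  have hs : P.Sub (Function.update Tm.var x N) Γ Γ (𝟙 _) :=
    (Sub.id hx.2).congr fun w hw => (Function.update_of_ne (fun e => hx.1 (by rwa [← e])) _ _).symm
  refine (h.subst (hs.cons (x := x) (σ := σ) (g := g') ?_ m)).congr_hom ?_
  · rwa [Function.update_self]
  · rw [← id_tensorHom]; exact Category.assoc _ _ _

theorem Den.subst2 {Γ Δ₁ Δ₂ Θ Ξ : Env} {x y : Var} {σ₁ σ₂ τ : Ty} {L M N : Tm S}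
    {g : (P.env Γ ⊗ P.ty σ₁) ⊗ P.ty σ₂ ⟶ P.ty τ} {g₁ : P.env Δ₁ ⟶ P.ty σ₁}
    {g₂ : P.env Δ₂ ⟶ P.ty σ₂} (h : P.Den ((y, σ₂) :: (x, σ₁) :: Γ) L τ g)
    (h₁ : P.Den Δ₁ M σ₁ g₁) (h₂ : P.Den Δ₂ N σ₂ g₂) (p : Merge Γ Δ₁ Θ) (q : Merge Θ Δ₂ Ξ) :
    P.Den Ξ (L.subst2 x M y N) τ
      (P.merge q ≫ P.merge p ▷ P.env Δ₂ ≫ ((𝟙 (P.env Γ) ⊗ₘ g₁) ⊗ₘ g₂) ≫ g) := by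
  have hy := Env.nodup_cons.1 h.nodup
  have hx := Env.nodup_cons.1 hy.2
  have hyx : x ≠ y := fun e => hy.1 (e ▸ List.mem_cons_self)
  have hs : P.Sub (Function.update (Function.update Tm.var x M) y N) Γ Γ (𝟙 _) :=
    (Sub.id hx.2).congr fun w hw => by
      rw [Function.update_of_ne (fun e => hy.1 (List.mem_cons_of_mem _ (by rwa [← e]))),
        Function.update_of_ne (fun e => hx.1 (by rwa [← e]))]
  refine (h.subst ((hs.cons (x := x) (σ := σ₁) (g := g₁) ?_ p).cons
    (x := y) (σ := σ₂) (g := g₂) ?_ q)).congr_hom ?_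
  · rwa [Function.update_of_ne hyx, Function.update_self]
  · rwa [Function.update_self]
  · have : (P.merge p ≫ (𝟙 (P.env Γ) ⊗ₘ g₁) ⊗ₘ g₂) =
        P.merge p ▷ P.env Δ₂ ≫ ((𝟙 (P.env Γ) ⊗ₘ g₁) ⊗ₘ g₂) := by
      rw [← tensorHom_id, tensorHom_comp_tensorHom, Category.id_comp]
    refine (Category.assoc _ _ _).trans ?_
    congr 1
    refine (congrArg (· ≫ g) this).trans ?_
    simp

theorem Den.beta {Ξ : Env} {x : Var} {σ τ : Ty} {M N : Tm S} {g : P.env Ξ ⟶ P.ty τ}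
    (h : P.Den Ξ (.app (.lam x σ M) N) τ g) : P.Den Ξ (M.subst1 x N) τ g := by
  obtain ⟨D, rfl⟩ := h
  cases D with
  | app D₁ D₂ m =>
    cases D₁ with
    | lam D₁ =>
      refine (Den.subst1 ⟨D₁, rfl⟩ ⟨D₂, rfl⟩ m).congr_hom ?_
      simp only [interp]
      exact congrArg _ (rcurry_tensorHom_reval _ _).symm

theorem Den.starBeta {Ξ : Env} {τ : Ty} {M : Tm S} {g : P.env Ξ ⟶ P.ty τ}
    (h : P.Den Ξ (.letStar .star M) τ g) : P.Den Ξ M τ g := by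
  obtain ⟨D, rfl⟩ := h
  cases D with
  | letStar D₁ D₂ m =>
    cases D₁
    obtain rfl := m.eq_of_nil
    refine Den.congr_hom ⟨D₂, rfl⟩ ?_
    simp only [interp]
    rw [merge_nil]
    change _ = (λ_ _).inv ≫ (𝟙 (𝟙_ C) ⊗ₘ _) ≫ (λ_ _).hom
    simp

theorem Den.pairBeta {Ξ : Env} {x y : Var} {τ : Ty} {M N L : Tm S} {g : P.env Ξ ⟶ P.ty τ}
    (h : P.Den Ξ (.letPair x y (.tensor M N) L) τ g) : P.Den Ξ (L.subst2 x M y N) τ g := by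
  obtain ⟨D, rfl⟩ := h
  cases D with
  | letPair D₁ D₂ m =>
    cases D₁ with
    | tensor D₁ D₁' n =>
      -- `Den.subst2` adds the environments of `M` and `N` one after the other to that of `L`, so
      -- the whole is regrouped with the environment of `L` first.
      obtain ⟨Θ, p, q, e⟩ := P.merge_assoc_inv m.symm n
      refine (Den.subst2 ⟨D₂, rfl⟩ ⟨D₁, rfl⟩ ⟨D₁', rfl⟩ p q).congr_hom ?_
      rw [merge_symm] at e
      simp only [interp]
      exact tensorHom_pairBeta e _ _ _

/-! ### Soundness of the evaluation -/

theorem DenArgs.map : ∀ {n : ℕ} {Ms Ns : Fin (n + 1) → Tm S} {Γ : Env}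
    {g : P.env Γ ⟶ tens n fun _ => P.real}
    (_ : ∀ (i : Fin (n + 1)) {Γ : Env} {g : P.env Γ ⟶ P.ty .R},
      P.Den Γ (Ms i) .R g → P.Den Γ (Ns i) .R g),
    P.DenArgs n Ms Γ g → P.DenArgs n Ns Γ g
  | 0, _, _, _, _, H, h => H 0 h
  | _ + 1, _, _, _, _, H, ⟨_, _, m, g₁, g₂, h₁, h₂, e⟩ =>
    ⟨_, _, m, g₁, g₂, DenArgs.map (fun i => H i.castSucc) h₁, H _ h₂, e⟩

/-- Preservation of the type and of the interpretation are proved together, by induction on the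
evaluation. The computation steps are the β rules and (M1). -/
theorem Den.eval {M V : Tm S} (e : Eval M V)
    (M1 : ∀ (f : S) (a : Fin (f.1.n + 1) → ℝ) (b : ℝ), f.1.fn a = b →
      P.den (typed_fn_nums f a) = P.den (typed_num b)) :
    ∀ {Γ : Env} {τ : Ty} {g : P.env Γ ⟶ P.ty τ}, P.Den Γ M τ g → P.Den Γ V τ g := by
  induction e with
  | value _ => exact fun h => h
  | fn f _ ih =>
    rintro Γ τ g ⟨D, rfl⟩
    cases D with
    | fn _ D m =>
      have h := P.den_fn (DenArgs.map (fun i => ih i) (P.denArgs_of_mergeN m D))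
      -- All arguments have become numerals, so the term has no free variable and (M1), which
      -- concerns the empty environment, applies.
      obtain rfl : Γ = [] := by
        refine List.eq_nil_iff_forall_not_mem.2 fun z hz => ?_
        simpa [Tm.fv] using (h.mem_vars z.1).1 (List.mem_map_of_mem hz)
      have e := h.den_eq (typed_fn_nums f _)
      rw [M1 f _ _ rfl] at e
      exact (P.den_den _).congr_hom (e.trans (P.interp_fn f D m).symm)
  | app _ _ _ _ ih₁ ih₂ ih₃ =>
    rintro Γ τ g ⟨D, rfl⟩
    cases D with
    | app D₁ D₂ m =>
      have h₁ := ih₁ ⟨D₁, rfl⟩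
      obtain ⟨D₁', h₁'⟩ := id h₁
      cases D₁'
      simp only [interp]
      exact ih₃ (P.den_app m h₁ (ih₂ ⟨D₂, rfl⟩)).beta
  | tensor _ _ ih₁ ih₂ =>
    rintro Γ τ g ⟨D, rfl⟩
    cases D with
    | tensor D₁ D₂ m =>
      simp only [interp]
      exact P.den_tensor m (ih₁ ⟨D₁, rfl⟩) (ih₂ ⟨D₂, rfl⟩)
  | letStar _ _ ih₁ ih₂ =>
    rintro Γ τ g ⟨D, rfl⟩
    cases D with
    | letStar D₁ D₂ m =>
      simp only [interp]
      exact (P.den_letStar m (ih₁ ⟨D₁, rfl⟩) (ih₂ ⟨D₂, rfl⟩)).starBeta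
  | letPair _ _ ih₁ ih₂ =>
    rintro Γ τ g ⟨D, rfl⟩
    cases D with
    | letPair D₁ D₂ m =>
      simp only [interp]
      exact ih₂ (P.den_letPair m (ih₁ ⟨D₁, rfl⟩) ⟨D₂, rfl⟩).pairBeta

end PreModel

/-! ### Enriched categories -/

section Enriched

variable {C : Type u} [Category.{v} C] [MonoidalCategory C] [SymmetricCategory C]
  [MonoidalClosed C] [∀ X Y : C, PseudoEMetricSpace (X ⟶ Y)] [MetEnriched C]

theorem edist_comp_left_le {X Y Z : C} (f : X ⟶ Y) (g g' : Y ⟶ Z) :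
    edist (f ≫ g) (f ≫ g') ≤ edist g g' := by
  simpa using MetEnriched.comp f f g g'

theorem edist_comp_right_le {X Y Z : C} (g g' : X ⟶ Y) (f : Y ⟶ Z) :
    edist (g ≫ f) (g' ≫ f) ≤ edist g g' := by
  simpa using MetEnriched.comp g g' f f

theorem edist_whiskerRight_le {X Y : C} (g g' : X ⟶ Y) (Z : C) :
    edist (g ▷ Z) (g' ▷ Z) ≤ edist g g' := by
  simpa using MetEnriched.tensor g g' (𝟙 Z) (𝟙 Z)

theorem edist_rcurry_associator_le {A X Y Z : C} (g g' : A ⊗ X ⊗ Y ⟶ Z) :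
    edist (rcurry ((α_ _ _ _).hom ≫ g)) (rcurry ((α_ _ _ _).hom ≫ g')) ≤ edist g g' := by
  rw [MetEnriched.curry]
  exact edist_comp_left_le _ _ _

end Enriched

section Tensor

variable {C : Type u} [Category.{v} C] [MonoidalCategory C]

/-- This turns a merge taken before applying `f` into one in which `A` is kept apart, as needed when
the hole lies in one of two subterms. -/
theorem merge_strength {A Θ Γ Δ Ξ X Y Z : C} {m : X ⟶ A ⊗ Ξ} {m₀ : Ξ ⟶ Γ ⊗ Δ} {p : Θ ⟶ A ⊗ Γ}
    {q : X ⟶ Θ ⊗ Δ} (e : q ≫ p ▷ Δ ≫ (α_ _ _ _).hom = m ≫ A ◁ m₀) (f : A ⊗ Γ ⟶ Y)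
    (k : Y ⊗ Δ ⟶ Z) :
    q ≫ (p ≫ f) ▷ Δ ≫ k = m ≫ A ◁ m₀ ≫ (α_ _ _ _).inv ≫ f ▷ Δ ≫ k := by
  rw [← reassoc_of% e, Iso.hom_inv_id_assoc, comp_whiskerRight_assoc]

end Tensor

namespace PreModel

variable {C : Type u} [Category.{v} C] [MonoidalCategory C] [SymmetricCategory C]
  [MonoidalClosed C] {S : Set FunSym} {P : PreModel C S}
  [∀ X Y : C, PseudoEMetricSpace (X ⟶ Y)]

/-! ### Interpretation of contexts -/

variable (P) in
/-- `F` interprets a context that binds the variables in `B`, uses the environment `Γ` and whose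
hole has type `π` in the environment `Θ`: whenever the hole is filled with a term that uses an
additional environment `Γ₁`, the relation `Q` between the filled term and its interpretation
holds. -/
structure Strength (B : Finset Var) (Θ : Env) (π : Ty) (Γ : Env) {Y : C}
    (Q : Tm S → (Γ : Env) → (P.env Γ ⟶ Y) → Prop)
    (F : (A : C) → (A ⊗ P.env Θ ⟶ P.ty π) → (A ⊗ P.env Γ ⟶ Y)) : Prop where
  natural : ∀ {A A' : C} (a : A ⟶ A') (g : A' ⊗ P.env Θ ⟶ P.ty π),
    F A (a ▷ P.env Θ ≫ g) = a ▷ P.env Γ ≫ F A' g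
  edist_le : ∀ {A : C} (g g' : A ⊗ P.env Θ ⟶ P.ty π), edist (F A g) (F A g') ≤ edist g g'
  fill : ∀ {Γ₁ Γ' Θ' : Env} (m : Merge Γ₁ Γ Γ') (n : Merge Γ₁ Θ Θ'), (∀ z ∈ Γ₁.vars, z ∉ B) →
    ∀ {L : Tm S} {g : P.env Θ' ⟶ P.ty π}, P.Den Θ' L π g →
      Q L Γ' (P.merge m ≫ F (P.env Γ₁) (inv (P.merge n) ≫ g))

variable (P) in
/-- Every part `Γ₁` of the environment `Θ` of the hole that is not bound by the context comes from
the environment `Γ`, and the context has an interpretation with respect to the other parts. -/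
def Fillable (B : Finset Var) (Θ : Env) (π : Ty) (Γ : Env) {Y : C}
    (Q : Tm S → (Γ : Env) → (P.env Γ ⟶ Y) → Prop) : Prop :=
  ∀ (Γ₁ Θ₀ : Env) (_ : Merge Γ₁ Θ₀ Θ), (∀ z ∈ Γ₁.vars, z ∉ B) →
    ∃ (Γ₀ : Env) (_ : Merge Γ₁ Γ₀ Γ)
      (F : (A : C) → (A ⊗ P.env Θ₀ ⟶ P.ty π) → (A ⊗ P.env Γ₀ ⟶ Y)), P.Strength B Θ₀ π Γ₀ Q F

/-- The hole acts as the identity; the two merges in `Strength.fill` may still order the variables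
differently, which `Den.exchange` absorbs. -/
theorem Fillable.hole (Γ : Env) (π : Ty) : P.Fillable ∅ Γ π Γ fun L Γ g => P.Den Γ L π g :=
  fun _ Θ₀ n _ => ⟨Θ₀, n, fun _ g => g, fun _ _ => rfl, fun _ _ => le_rfl,
    fun m n _ _ _ h => h.exchange n m⟩

variable [MetEnriched C]

theorem Fillable.post {B : Finset Var} {Θ : Env} {π : Ty} {Γ : Env} {Y Z : C}
    {Q : Tm S → (Γ : Env) → (P.env Γ ⟶ Y) → Prop} {Q' : Tm S → (Γ : Env) → (P.env Γ ⟶ Z) → Prop}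
    (h : P.Fillable B Θ π Γ Q) (k : Y ⟶ Z) (H : ∀ {L Γ g}, Q L Γ g → Q' L Γ (g ≫ k)) :
    P.Fillable B Θ π Γ Q' := by
  intro Γ₁ Θ₀ n hB
  obtain ⟨Γ₀, m, F, hF⟩ := h _ _ n hB
  refine ⟨Γ₀, m, fun A g => F A g ≫ k, fun a g => ?_, fun g g' => ?_, fun m n hB L g hL => ?_⟩
  · rw [hF.natural, Category.assoc]
  · exact (edist_comp_right_le _ _ _).trans (hF.edist_le g g')
  · rw [← Category.assoc]
    exact H (hF.fill m n hB hL)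

/-- For a hole in the left of two subterms, the parameter `A` is reassociated past `Δ` and the old
family is tensored with `Δ`. Both operations are natural in `A` and non-expansive. The other subterm
is hidden in `k`. -/
theorem Fillable.left {B : Finset Var} {Θ : Env} {π : Ty} {Γ Δ Ξ : Env} {Y Z : C}
    {Q : Tm S → (Γ : Env) → (P.env Γ ⟶ Y) → Prop} {Q' : Tm S → (Γ : Env) → (P.env Γ ⟶ Z) → Prop}
    (h : P.Fillable B Θ π Γ Q) (m₀ : Merge Γ Δ Ξ) (k : Y ⊗ P.env Δ ⟶ Z)
    (H : ∀ {L Γ' Ξ' g} (m : Merge Γ' Δ Ξ'), Q L Γ' g → Q' L Ξ' (P.merge m ≫ g ▷ P.env Δ ≫ k)) :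
    P.Fillable B Θ π Ξ Q' := by
  intro Γ₁ Θ₀ n hB
  obtain ⟨Γ₀, m, F, hF⟩ := h _ _ n hB
  -- Only the environments matter here; the equation of morphisms is needed for an arbitrary `Γ₁`
  -- and is obtained again when the hole is filled.
  obtain ⟨Ξ₀, m₁, m₂, -⟩ := P.merge_assoc m₀ m
  refine ⟨Ξ₀, m₂, fun A g => A ◁ P.merge m₁ ≫ (α_ _ _ _).inv ≫ F A g ▷ P.env Δ ≫ k,
    fun a g => ?_, fun g g' => ?_, fun m n hB L g hL => ?_⟩
  · rw [hF.natural, comp_whiskerRight_assoc, ← associator_inv_naturality_left_assoc,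
      whisker_exchange_assoc]
  · exact (edist_comp_left_le _ _ _).trans <| (edist_comp_left_le _ _ _).trans <|
      (edist_comp_right_le _ _ _).trans <| (edist_whiskerRight_le _ _ _).trans (hF.edist_le g g')
  · obtain ⟨Γ', p, q, e⟩ := P.merge_assoc_inv m m₁
    have := H q (hF.fill p n hB hL)
    rwa [merge_strength e] at this

theorem Fillable.right {B : Finset Var} {Θ : Env} {π : Ty} {Γ Δ Ξ : Env} {Y Z : C}
    {Q : Tm S → (Γ : Env) → (P.env Γ ⟶ Y) → Prop} {Q' : Tm S → (Γ : Env) → (P.env Γ ⟶ Z) → Prop}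
    (h : P.Fillable B Θ π Γ Q) (m₀ : Merge Δ Γ Ξ) (k : P.env Δ ⊗ Y ⟶ Z)
    (H : ∀ {L Γ' Ξ' g} (m : Merge Δ Γ' Ξ'), Q L Γ' g → Q' L Ξ' (P.merge m ≫ P.env Δ ◁ g ≫ k)) :
    P.Fillable B Θ π Ξ Q' := by
  refine h.left m₀.symm ((β_ _ _).hom ≫ k) fun {L Γ' Ξ' g} m hL => ?_
  have := H m.symm hL
  rwa [merge_symm, Category.assoc, ← BraidedCategory.braiding_naturality_left_assoc] at this

/-- Currying is natural and isometric, so it preserves both properties of the family. The operation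
`T` is arbitrary so that the lemma can be applied twice in succession for a pair of binders. -/
theorem Fillable.lam {B : Finset Var} {Θ : Env} {π : Ty} {Γ : Env} {x : Var} {σ τ : Ty}
    {T : Tm S → Tm S} (hx : x ∉ Γ.vars)
    (h : P.Fillable B Θ π ((x, σ) :: Γ) fun L Γ g => P.Den Γ (T L) τ g) :
    P.Fillable (insert x B) Θ π Γ fun L Γ g => P.Den Γ (.lam x σ (T L)) (.lolli σ τ) g := by
  intro Γ₁ Θ₀ n hB
  obtain ⟨Γ₀, m, F, hF⟩ := h _ _ n fun z hz hz' => hB z hz (Finset.mem_insert_of_mem hz')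
  cases m with
  -- The bound variable cannot belong to the part `Γ₁`, which avoids everything bound by the
  -- context; it stays in the other part and is curried away.
  | left => exact absurd (Finset.mem_insert_self _ _) (hB _ List.mem_cons_self)
  | @right _ Γ₀ _ _ _ _ m =>
    refine ⟨Γ₀, m, fun A g => rcurry ((α_ _ _ _).hom ≫ F A g), fun a g => ?_, fun g g' => ?_,
      fun {Γ₁ Γ' Θ'} m' n hB L g hL => ?_⟩
    · rw [hF.natural]
      exact rcurry_associator_whiskerRight a _
    · exact (edist_rcurry_associator_le _ _).trans (hF.edist_le g g')
    · have hx' : x ∉ Γ'.vars := fun hx' => ((m'.mem_vars x).1 hx').elim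
        (fun h => hB x h (Finset.mem_insert_self _ _)) (fun h => hx ((m.mem_vars x).2 (.inr h)))
      have := hF.fill (.right x σ hx' m') n
        (fun z hz hz' => hB z hz (Finset.mem_insert_of_mem hz')) hL
      refine (P.den_lam (this.congr_hom ?_)).congr_hom (comp_rcurry _ _).symm
      rw [merge_right]
      exact Category.assoc _ _ _

theorem DenArgs.fillable {T : Tm S → Tm S} : ∀ {n : ℕ}
    {Ms : Fin (n + 1) → Tm S} {Ξ : Env} {g : P.env Ξ ⟶ tens n fun _ => P.real}
    (_ : P.DenArgs n Ms Ξ g) (i : Fin (n + 1)),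
    ∃ (Γ : Env) (g' : P.env Γ ⟶ P.ty .R), P.Den Γ (Ms i) .R g' ∧
      (∀ {B : Finset Var} {Θ : Env} {π : Ty},
        P.Fillable B Θ π Γ (fun L Γ g => P.Den Γ (T L) .R g) →
          P.Fillable B Θ π Ξ fun L Ξ g => P.DenArgs n (Function.update Ms i (T L)) Ξ g)
  | 0, Ms, Ξ, g, h, i => by
    obtain rfl := Fin.fin_one_eq_zero i
    refine ⟨Ξ, g, h, fun H => ?_⟩
    simp only [DenArgs, Function.update_self]
    exact H
  | n + 1, Ms, Ξ, g, ⟨Γ, Δ, m, g₁, g₂, h₁, h₂, e⟩, i => by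
    induction i using Fin.lastCases with
    | last =>
      refine ⟨Δ, g₂, h₂, fun H => H.right m (g₁ ▷ _) fun {L Γ' Ξ' g} m' hL => ?_⟩
      refine ⟨_, _, m', g₁, g, ?_, by rwa [Function.update_self], ?_⟩
      · simpa [Function.update_of_ne (Fin.castSucc_lt_last _).ne] using h₁
      · exact congrArg _ (MonoidalCategory.tensorHom_def' _ _).symm
    | cast i =>
      obtain ⟨Γi, g', h', H⟩ := DenArgs.fillable h₁ i
      refine ⟨Γi, g', h', fun hi => (H hi).left m (_ ◁ g₂) fun {L Γ' Ξ' g} m' hL => ?_⟩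
      refine ⟨_, _, m', g, g₂, ?_, ?_, ?_⟩
      · convert hL using 1
        funext j
        simp [Function.update_apply]
      · rwa [Function.update_of_ne (Fin.castSucc_lt_last _).ne']
      · exact congrArg _ (MonoidalCategory.tensorHom_def _ _).symm

end PreModel

section Tensor

variable {C : Type u} [Category.{v} C] [MonoidalCategory C] [SymmetricCategory C]

/-- A body under `let x ⊗ y` may be curried twice and evaluated again. This reduces the binding of a
pair around a hole to two abstractions. -/
theorem letPair_rcurry [MonoidalClosed C] {X Y Z₁ Z₂ W : C} (g₁ : X ⟶ Z₁ ⊗ Z₂)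
    (g : (Y ⊗ Z₁) ⊗ Z₂ ⟶ W) :
    X ◁ rcurry (rcurry g) ≫ g₁ ▷ _ ≫ (β_ _ _).hom ≫ (α_ _ _ _).inv ≫ reval _ _ ▷ Z₂ ≫ reval _ _ =
      g₁ ▷ Y ≫ (β_ _ _).hom ≫ (α_ _ _ _).inv ≫ g := by
  rw [whisker_exchange_assoc, BraidedCategory.braiding_naturality_right_assoc,
    associator_inv_naturality_left_assoc, ← comp_whiskerRight_assoc, rcurry_reval, rcurry_reval]

end Tensor

namespace PreModel

variable {C : Type u} [Category.{v} C] [MonoidalCategory C] [SymmetricCategory C]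
  [MonoidalClosed C] {S : Set FunSym} {P : PreModel C S}
  [∀ X Y : C, PseudoEMetricSpace (X ⟶ Y)] [MetEnriched C]

/-- A typed term `K[M]` determines an interpretation of the context `K`. -/
theorem Den.fillable {K : Ctx S} : ∀ {Γ : Env} {M : Tm S} {σ : Ty} {g : P.env Γ ⟶ P.ty σ},
    P.Den Γ (K.fill M) σ g → ∃ (Θ : Env) (π : Ty) (g₀ : P.env Θ ⟶ P.ty π), P.Den Θ M π g₀ ∧
      P.Fillable K.bound Θ π Γ fun L Γ g => P.Den Γ (K.fill L) σ g := by
  induction K with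
  | hole => exact fun h => ⟨_, _, _, h, Fillable.hole _ _⟩
  | fn f i Ms K ih =>
    rintro Γ M σ g ⟨D, rfl⟩
    cases D with
    | fn _ D m =>
      obtain ⟨Γi, gi, hi, H⟩ := DenArgs.fillable (T := K.fill) (P.denArgs_of_mergeN m D) i
      rw [Function.update_self] at hi
      obtain ⟨Θ, π, g₀, h₀, hΘ⟩ := ih hi
      refine ⟨Θ, π, g₀, h₀, ?_⟩
      have := H hΘ
      simp only [Function.update_idem] at this
      exact this.post (P.fn f) fun h => P.den_fn h
  | appL K N ih =>
    rintro Γ M σ g ⟨D, rfl⟩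
    cases D with
    | app D₁ D₂ m =>
      obtain ⟨Θ, π, g₀, h₀, hΘ⟩ := ih ⟨D₁, rfl⟩
      exact ⟨Θ, π, g₀, h₀, hΘ.left m (_ ◁ P.interp D₂ ≫ reval _ _) fun n hL =>
        (P.den_app n hL ⟨D₂, rfl⟩).congr_hom
          (congrArg _ (MonoidalCategory.tensorHom_def_assoc _ _ _))⟩
  | appR N K ih =>
    rintro Γ M σ g ⟨D, rfl⟩
    cases D with
    | app D₁ D₂ m =>
      obtain ⟨Θ, π, g₀, h₀, hΘ⟩ := ih ⟨D₂, rfl⟩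
      exact ⟨Θ, π, g₀, h₀, hΘ.right m (P.interp D₁ ▷ _ ≫ reval _ _) fun n hL =>
        (P.den_app n ⟨D₁, rfl⟩ hL).congr_hom
          (congrArg _ (MonoidalCategory.tensorHom_def'_assoc _ _ _))⟩
  | lam x τ K ih =>
    rintro Γ M σ g ⟨D, rfl⟩
    cases D with
    | lam D =>
      obtain ⟨Θ, π, g₀, h₀, hΘ⟩ := ih ⟨D, rfl⟩
      exact ⟨Θ, π, g₀, h₀, hΘ.lam (Env.nodup_cons.1 D.nodup).1⟩
  | tensorL K N ih =>
    rintro Γ M σ g ⟨D, rfl⟩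
    cases D with
    | tensor D₁ D₂ m =>
      obtain ⟨Θ, π, g₀, h₀, hΘ⟩ := ih ⟨D₁, rfl⟩
      exact ⟨Θ, π, g₀, h₀, hΘ.left m (_ ◁ P.interp D₂) fun n hL =>
        (P.den_tensor n hL ⟨D₂, rfl⟩).congr_hom
          (congrArg _ (MonoidalCategory.tensorHom_def _ _))⟩
  | tensorR N K ih =>
    rintro Γ M σ g ⟨D, rfl⟩
    cases D with
    | tensor D₁ D₂ m =>
      obtain ⟨Θ, π, g₀, h₀, hΘ⟩ := ih ⟨D₂, rfl⟩
      exact ⟨Θ, π, g₀, h₀, hΘ.right m (P.interp D₁ ▷ _) fun n hL =>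
        (P.den_tensor n ⟨D₁, rfl⟩ hL).congr_hom
          (congrArg _ (MonoidalCategory.tensorHom_def' _ _))⟩
  | letStarL K N ih =>
    rintro Γ M σ g ⟨D, rfl⟩
    cases D with
    | letStar D₁ D₂ m =>
      obtain ⟨Θ, π, g₀, h₀, hΘ⟩ := ih ⟨D₁, rfl⟩
      exact ⟨Θ, π, g₀, h₀, hΘ.left m (𝟙_ C ◁ P.interp D₂ ≫ (λ_ _).hom) fun n hL =>
        (P.den_letStar n hL ⟨D₂, rfl⟩).congr_hom
          (congrArg _ (MonoidalCategory.tensorHom_def_assoc _ _ _))⟩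
  | letStarR N K ih =>
    rintro Γ M σ g ⟨D, rfl⟩
    cases D with
    | letStar D₁ D₂ m =>
      obtain ⟨Θ, π, g₀, h₀, hΘ⟩ := ih ⟨D₂, rfl⟩
      exact ⟨Θ, π, g₀, h₀, hΘ.right m (P.interp D₁ ▷ _ ≫ (λ_ _).hom) fun n hL =>
        (P.den_letStar n ⟨D₁, rfl⟩ hL).congr_hom
          (congrArg _ (MonoidalCategory.tensorHom_def'_assoc _ _ _))⟩
  | letPairL x y K N ih =>
    rintro Γ M σ g ⟨D, rfl⟩
    cases D with
    | letPair D₁ D₂ m =>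
      obtain ⟨Θ, π, g₀, h₀, hΘ⟩ := ih ⟨D₁, rfl⟩
      exact ⟨Θ, π, g₀, h₀, hΘ.left m ((β_ _ _).hom ≫ (α_ _ _ _).inv ≫ P.interp D₂) fun n hL =>
        P.den_letPair n hL ⟨D₂, rfl⟩⟩
  | letPairR x y N K ih =>
    rintro Γ M σ g ⟨D, rfl⟩
    cases D with
    | letPair D₁ D₂ m =>
      obtain ⟨Θ, π, g₀, h₀, hΘ⟩ := ih ⟨D₂, rfl⟩
      have hy := Env.nodup_cons.1 D₂.nodup
      have hx := Env.nodup_cons.1 hy.2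
      -- The body is treated as the right component λx. λy. K[-], and the postcomposed morphism
      -- feeds it the two components of `N`.
      refine ⟨Θ, π, g₀, h₀, ((hΘ.lam (T := K.fill) hy.1).lam
        (T := fun L => .lam y _ (K.fill L)) hx.1).right m
        (P.interp D₁ ▷ _ ≫ (β_ _ _).hom ≫ (α_ _ _ _).inv ≫ reval _ _ ▷ _ ≫ reval _ _) ?_⟩
      rintro L Γ' Ξ' g n ⟨D, rfl⟩
      cases D with
      | lam D =>
        cases D with
        | lam D =>
          refine (P.den_letPair n ⟨D₁, rfl⟩ ⟨D, rfl⟩).congr_hom ?_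
          simp only [interp]
          exact congrArg _ (letPair_rcurry _ _).symm

end PreModel

/-! ### Typing of the hole and non-expansiveness of contexts -/

/-- The term `(λ x₁ … xₙ. M) x₁ … xₙ` for the environment `Γ = x₁, …, xₙ`. -/
def force {S : Set FunSym} : Env → Tm S → Tm S
  | [], M => M
  | (x, τ) :: Γ, M => .app (force Γ (.lam x τ M)) (.var x)

theorem typed_force {S : Set FunSym} : ∀ {Γ : Env} {M : Tm S} {τ : Ty}, Typed Γ M τ →
    Typed Γ (force Γ M) τ
  | [], _, _, h => h
  | (_, _) :: _, _, _, ⟨D⟩ =>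
    ⟨.app (typed_force ⟨.lam D⟩).some (.var _ _)
      (Merge.single _ _ (Env.nodup_cons.1 D.nodup).1 (Env.nodup_cons.1 D.nodup).2)⟩

/-- A bare term such as a variable can be typed in environments with different types. Here the
annotations on the abstractions fix the type of every variable of `Γ`. -/
theorem Deriv.of_force {S : Set FunSym} : ∀ {Γ Γ' : Env} {M : Tm S} {τ : Ty},
    Deriv Γ' (force Γ M) τ → (∃ Θ, Typed Θ M τ) ∧ Γ ⊆ Γ'
  | [], _, _, _, D => ⟨⟨_, ⟨D⟩⟩, List.nil_subset _⟩
  | (x, σ) :: Γ, Γ', M, τ, D => by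
    rw [force] at D
    cases D with
    | app D₁ D₂ m =>
      obtain ⟨⟨Θ, ⟨D⟩⟩, h⟩ := of_force D₁
      cases D with
      | lam D =>
        cases D₂
        refine ⟨⟨_, ⟨D⟩⟩, List.cons_subset.2 ⟨(m.mem _).2 (.inr List.mem_cons_self), ?_⟩⟩
        exact fun p hp => (m.mem p).2 (.inl (h hp))

/-- `Γ` is contained in `Γ'` by `Deriv.of_force`, and both list without repetition the free
variables of the same term. -/
theorem Deriv.perm_of_force {S : Set FunSym} {Γ Γ' : Env} {M : Tm S} {τ τ' : Ty}
    (h : Typed Γ M τ) (D : Deriv Γ' (force Γ M) τ') : Γ.Perm Γ' := by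
  obtain ⟨D₀⟩ := typed_force h
  have hs := D.of_force.2
  refine (List.perm_ext_iff_of_nodup (.of_map _ D₀.nodup) (.of_map _ D.nodup)).2 fun p =>
    ⟨fun hp => hs hp, fun hp => ?_⟩
  obtain ⟨q, hq, e⟩ := List.mem_map.1
    ((D₀.mem_vars p.1).2 ((D.mem_vars p.1).1 (List.mem_map_of_mem hp)))
  rwa [← List.inj_on_of_nodup_map D.nodup (hs hq) hp e]

namespace PreModel

variable {C : Type u} [Category.{v} C] [MonoidalCategory C] [SymmetricCategory C]
  [MonoidalClosed C] {S : Set FunSym} (P : PreModel C S)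
  [∀ X Y : C, PseudoEMetricSpace (X ⟶ Y)] [MetEnriched C]

/-- The map `G` is the family of `K` at A = I, read off from the single term K[force Γ M₀], and it
then serves for every `M`. The term `M₀` only witnesses that the context can be filled. -/
theorem exists_den_fill {K : Ctx S} {Γ Δ : Env} {τ σ : Ty} (hK : K.Maps Γ τ Δ σ)
    (M₀ : Term S Γ τ) : ∃ G : (P.env Γ ⟶ P.ty τ) → (P.env Δ ⟶ P.ty σ),
      (∀ g g', edist (G g) (G g') ≤ edist g g') ∧
        ∀ M : Term S Γ τ, P.den (hK M.1 M.2) = G (P.den M.2) := by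
  have hf := typed_force M₀.2
  obtain ⟨Θ, π, g₀, h₀, hΘ⟩ := (P.den_den (hK _ hf)).fillable
  -- The hole environment is a permutation of `Γ`; the resulting identity substitution retypes all
  -- terms there, with the same `s`.
  obtain ⟨s, hs⟩ := Sub.exists_of_perm (P := P) h₀.nodup (h₀.choose.perm_of_force M₀.2)
  have hsub : ∀ {M : Tm S} {τ : Ty} (h : Typed Γ M τ), P.Den Θ M τ (s ≫ P.den h) := fun h => by
    have := (P.den_den h).subst hs
    rwa [h.some.subst_var] at this
  obtain rfl : π = τ := (h₀.choose.unique (hsub hf).choose).1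
  obtain ⟨Γ₀, m, F, hF⟩ := hΘ _ _ (Merge.nilLeft Θ h₀.nodup) (by simp [Env.vars])
  refine ⟨fun g => P.merge m ≫ F _ (inv (P.merge (Merge.nilLeft Θ h₀.nodup)) ≫ s ≫ g),
    fun g g' => ?_, fun M => ?_⟩
  · exact (edist_comp_left_le _ _ _).trans <| (hF.edist_le _ _).trans <|
      (edist_comp_left_le _ _ _).trans (edist_comp_left_le _ _ _)
  · exact (hF.fill m _ (by simp [Env.vars]) (hsub M.2)).den_eq _

end PreModel

/-! ### Categorical identities for the η rules, commuting conversions and constants -/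

section Tensor

variable {C : Type u} [Category.{v} C] [MonoidalCategory C]

theorem starEta_hom {W : C} (g : W ⟶ 𝟙_ C) :
    (ρ_ W).inv ≫ (g ⊗ₘ 𝟙 (𝟙_ C)) ≫ (λ_ (𝟙_ C)).hom = g := by
  simp [unitors_equal]

theorem eta_hom {X Y Z W : C} (g : X ⟶ Y) (k : Y ⊗ Z ⟶ W) :
    X ◁ (λ_ Z).inv ≫ (g ⊗ₘ (λ_ Z).hom) ≫ k = g ▷ Z ≫ k := by
  rw [MonoidalCategory.tensorHom_def', Category.assoc, ← MonoidalCategory.whiskerLeft_comp_assoc]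
  simp

theorem id_whiskerRight_whiskerRight_comp {X Y Z W : C} (g : (X ⊗ Y) ⊗ Z ⟶ W) :
    𝟙 X ▷ Y ▷ Z ≫ g = g := by
  simp

/-- With `f` = ⟦M⟧ and `g` = ⟦N⟧, the conversion for `let *` is naturality of the family along `f`,
whose target is the unit: `let *` leaves no variable at the hole. -/
theorem letStar_natural {G T X Y Z V : C} {F : (A : C) → (A ⊗ T ⟶ Y) → (A ⊗ G ⟶ Z)}
    (hF : ∀ {A A' : C} (a : A ⟶ A') (g : A' ⊗ T ⟶ Y), F A (a ▷ T ≫ g) = a ▷ G ≫ F A' g)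
    (f : X ⟶ 𝟙_ C) (g : T ⟶ Y) (n : V ⟶ X ⊗ T) [IsIso n] {l : T ⟶ 𝟙_ C ⊗ T}
    (_ : IsIso l) (hl : l = (λ_ T).inv) :
    (f ⊗ₘ (λ_ G).inv ≫ F (𝟙_ C) (inv l ≫ g)) ≫ (λ_ Z).hom =
      F X (inv n ≫ n ≫ (f ⊗ₘ g) ≫ (λ_ Y).hom) := by
  have h : (f ⊗ₘ g) ≫ (λ_ Y).hom = f ▷ T ≫ inv l ≫ g := by
    subst hl
    simp [MonoidalCategory.tensorHom_def]
  rw [IsIso.inv_hom_id_assoc, h, hF]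
  simp [MonoidalCategory.tensorHom_def]

theorem leftUnitor_inv_tensorHom {X Y Z V : C} (u : 𝟙_ C ⟶ X) (t : X ⟶ Y) (r : Y ⟶ Z)
    (x : 𝟙_ C ⟶ V) :
    (λ_ (𝟙_ C)).inv ≫ (u ≫ t ≫ r ⊗ₘ x) = ((λ_ _).inv ≫ u ▷ 𝟙_ C) ≫ (t ⊗ₘ x) ≫ r ▷ V := by
  rw [← tensorHom_id, ← tensorHom_id, Category.assoc, tensorHom_comp_tensorHom,
    tensorHom_comp_tensorHom, Category.id_comp, Category.comp_id]

variable [SymmetricCategory C]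

theorem leftUnitor_inv_swapLast (X Y : C) :
    (λ_ X).inv ▷ Y ≫ swapLast (𝟙_ C) X Y = (β_ X Y).hom ≫ (λ_ Y).inv ▷ X := by
  simp [swapLast]

theorem braiding_swapLast (X Y Z : C) :
    (β_ (X ⊗ Y) Z).hom ≫ (α_ Z X Y).inv ≫
      ((λ_ Z).inv ▷ X ≫ swapLast (𝟙_ C) Z X) ▷ Y ≫ swapLast (𝟙_ C ⊗ X) Z Y =
        (λ_ X).inv ▷ Y ▷ Z := by
  rw [leftUnitor_inv_swapLast, comp_whiskerRight_assoc, ← swapLast_natural_left,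
    ← reassoc_of% @associator_braiding, Iso.inv_hom_id_assoc, SymmetricCategory.symmetry_assoc]

theorem pairEta_hom {W X Y : C} (g : W ⟶ X ⊗ Y) :
    (ρ_ W).inv ≫ g ▷ 𝟙_ C ≫ (β_ _ _).hom ≫ (α_ (𝟙_ C) X Y).inv ≫
      (𝟙_ C ⊗ X) ◁ (λ_ Y).inv ≫ ((λ_ X).hom ⊗ₘ (λ_ Y).hom) = g := by
  rw [MonoidalCategory.tensorHom_def', ← MonoidalCategory.whiskerLeft_comp_assoc]
  simp

/-- The pair variant uses naturality twice: along `f`, and along `j`, which inserts the unit in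
front of the two components so as to form the environment of the two bound variables. -/
theorem letPair_natural {G T X Y Z V X₁ X₂ E : C} {F : (A : C) → (A ⊗ T ⟶ Y) → (A ⊗ G ⟶ Z)}
    (hF : ∀ {A A' : C} (a : A ⟶ A') (g : A' ⊗ T ⟶ Y), F A (a ▷ T ≫ g) = a ▷ G ≫ F A' g)
    (f : X ⟶ X₁ ⊗ X₂) (g : (T ⊗ X₁) ⊗ X₂ ⟶ Y) (n : V ⟶ X ⊗ T) [IsIso n] {j : X₁ ⊗ X₂ ⟶ E}
    {m : (G ⊗ X₁) ⊗ X₂ ⟶ E ⊗ G} {m' : (T ⊗ X₁) ⊗ X₂ ⟶ E ⊗ T} (_ : IsIso m')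
    (hm : (β_ _ _).hom ≫ (α_ _ _ _).inv ≫ m = j ▷ G)
    (hm' : (β_ _ _).hom ≫ (α_ _ _ _).inv ≫ m' = j ▷ T) :
    f ▷ G ≫ (β_ _ _).hom ≫ (α_ _ _ _).inv ≫ m ≫ F E (inv m' ≫ g) =
      F X (inv n ≫ n ≫ f ▷ T ≫ (β_ _ _).hom ≫ (α_ _ _ _).inv ≫ g) := by
  have h : (β_ (X₁ ⊗ X₂) T).hom ≫ (α_ _ _ _).inv ≫ g = j ▷ T ≫ inv m' ≫ g := by
    rw [← hm', Category.assoc, Category.assoc, IsIso.hom_inv_id_assoc]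
  rw [IsIso.inv_hom_id_assoc, h, hF, hF, ← hm]
  simp only [Category.assoc]

end Tensor

section Enriched

variable {C : Type u} [Category.{v} C] [MonoidalCategory C] [SymmetricCategory C]
  [MonoidalClosed C] [∀ X Y : C, PseudoEMetricSpace (X ⟶ Y)] [MetEnriched C]

/-- The maps on the left arise from those on the right by composing with fixed morphisms, since `u`
and `r` are invertible; composition cannot increase the distance. -/
theorem edist_le_edist_leftUnitor_inv_tensorHom {X Y Z V : C} (u : 𝟙_ C ≅ X) (r : Y ≅ Z)
    (t t' : X ⟶ Y) (x x' : 𝟙_ C ⟶ V) :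
    edist (t ⊗ₘ x) (t' ⊗ₘ x') ≤ edist ((λ_ (𝟙_ C)).inv ≫ (u.hom ≫ t ≫ r.hom ⊗ₘ x))
      ((λ_ (𝟙_ C)).inv ≫ (u.hom ≫ t' ≫ r.hom ⊗ₘ x')) := by
  have h : ∀ (t : X ⟶ Y) (x : 𝟙_ C ⟶ V), (t ⊗ₘ x) = (u.inv ▷ 𝟙_ C ≫ (λ_ _).hom) ≫
      ((λ_ (𝟙_ C)).inv ≫ (u.hom ≫ t ≫ r.hom ⊗ₘ x)) ≫ r.inv ▷ V := fun t x => by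
    rw [leftUnitor_inv_tensorHom]
    simp
  rw [h t, h t']
  exact (edist_comp_left_le _ _ _).trans (edist_comp_right_le _ _ _)

end Enriched

/-- The merge of a pair of variables with an environment. -/
def Merge.pair {Γ : Env} (x y : Var) (σ₁ σ₂ : Ty) (hx : x ∉ Γ.vars)
    (hy : y ∉ Env.vars ((x, σ₁) :: Γ)) (h : Γ.vars.Nodup) :
    Merge [(y, σ₂), (x, σ₁)] Γ ((y, σ₂) :: (x, σ₁) :: Γ) :=
  .left y σ₂ hy (.left x σ₁ hx (Merge.nilLeft Γ h))

namespace PreModel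

variable {C : Type u} [Category.{v} C] [MonoidalCategory C] [SymmetricCategory C]
  [MonoidalClosed C] {S : Set FunSym} {P : PreModel C S}

theorem braiding_merge_pair {Γ : Env} {x y : Var} {σ₁ σ₂ : Ty} (hx : x ∉ Γ.vars)
    (hy : y ∉ Env.vars ((x, σ₁) :: Γ)) (h : Γ.vars.Nodup) :
    (β_ (P.ty σ₁ ⊗ P.ty σ₂) (P.env Γ)).hom ≫ (α_ _ _ _).inv ≫
      P.merge (Merge.pair x y σ₁ σ₂ hx hy h) = (λ_ (P.ty σ₁)).inv ▷ P.ty σ₂ ▷ P.env Γ := by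
  rw [Merge.pair, merge_left, merge_left, merge_nilLeft]
  exact braiding_swapLast _ _ _

/-! ### Renaming of bound variables and eta rules -/

theorem Den.alphaLam {Γ : Env} {τ σ : Ty} {x z : Var} {M : Tm S} {g : P.env Γ ⟶ P.ty τ}
    (hz : z ∉ (Tm.lam x σ M).fv) (h : P.Den Γ (.lam x σ M) τ g) :
    P.Den Γ (.lam z σ (M.subst1 x (.var z))) τ g := by
  have hz' := mt (h.mem_vars z).1 hz
  obtain ⟨D, rfl⟩ := h
  cases D with
  | lam D =>
    have hx := Env.nodup_cons.1 D.nodup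
    refine (P.den_lam (Den.subst ⟨D, rfl⟩ ((Sub.id hx.2).bind σ hx.1 hz'))).congr_hom ?_
    simp only [interp]
    refine congrArg _ ?_
    rw [id_whiskerRight]
    exact Category.id_comp _

theorem Den.alphaLetPair {Γ : Env} {τ : Ty} {x y z w : Var} {M N : Tm S} {g : P.env Γ ⟶ P.ty τ}
    (hzw : z ≠ w) (hz : z ∉ (N.fv.erase x).erase y) (hw : w ∉ (N.fv.erase x).erase y)
    (h : P.Den Γ (.letPair x y M N) τ g) :
    P.Den Γ (.letPair z w M (N.subst2 x (.var z) y (.var w))) τ g := by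
  obtain ⟨D, rfl⟩ := h
  cases D with
  | @letPair _ Δ _ _ _ _ _ _ _ _ D₁ D₂ m =>
    have hy := Env.nodup_cons.1 D₂.nodup
    have hx := Env.nodup_cons.1 hy.2
    have hΔ : ∀ v ∈ Env.vars Δ, v ∈ (N.fv.erase x).erase y := fun v hv => by
      rw [Finset.mem_erase, Finset.mem_erase, ← D₂.mem_vars]
      exact ⟨fun e => hy.1 (List.mem_cons_of_mem _ (e ▸ hv)), fun e => hx.1 (e ▸ hv),
        List.mem_cons_of_mem _ (List.mem_cons_of_mem _ hv)⟩
    refine (P.den_letPair m ⟨D₁, rfl⟩ (Den.subst ⟨D₂, rfl⟩ (((Sub.id hx.2).bind _ hx.1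
      (mt (hΔ z) hz)).bind _ hy.1 ?_))).congr_hom ?_
    · intro h
      rcases List.mem_cons.1 h with h | h
      · exact hzw h.symm
      · exact hw (hΔ w h)
    · simp only [interp]
      refine congrArg _ (congrArg _ (congrArg _ (congrArg _ ?_)))
      exact id_whiskerRight_whiskerRight_comp _

theorem Den.eta {Γ : Env} {τ σ : Ty} {x : Var} {M : Tm S} {g : P.env Γ ⟶ P.ty (.lolli σ τ)}
    (hx : x ∉ M.fv) (h : P.Den Γ M (.lolli σ τ) g) :
    P.Den Γ (.lam x σ (.app M (.var x))) (.lolli σ τ) g := by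
  refine (P.den_lam (P.den_app (Merge.single x σ (mt (h.mem_vars x).1 hx) h.nodup) h
    (P.den_var x σ))).congr_hom ?_
  rw [merge_single]
  exact (congrArg rcurry (eta_hom g (reval _ _))).trans (rcurry_whiskerRight_reval g)

theorem Den.starEta {Γ : Env} {M : Tm S} {g : P.env Γ ⟶ P.ty .I} (h : P.Den Γ M .I g) :
    P.Den Γ (.letStar M .star) .I g := by
  refine (P.den_letStar (Merge.nilLeft Γ h.nodup).symm h P.den_star).congr_hom ?_
  rw [merge_nilLeft_symm]
  exact starEta_hom g

theorem Den.pairEta {Γ : Env} {τ σ : Ty} {x y : Var} {M : Tm S}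
    {g : P.env Γ ⟶ P.ty (.tensor τ σ)} (hxy : y ≠ x) (h : P.Den Γ M (.tensor τ σ) g) :
    P.Den Γ (.letPair x y M (.tensor (.var x) (.var y))) (.tensor τ σ) g := by
  refine (P.den_letPair (Merge.nilLeft Γ h.nodup).symm h (P.den_tensor
    (Merge.single y σ (by simpa [Env.vars] using hxy) (by simp [Env.vars]))
    (P.den_var x τ) (P.den_var y σ))).congr_hom ?_
  rw [merge_nilLeft_symm, merge_single]
  exact pairEta_hom g

/-! ### Tensor products of constants -/

variable (P) in
-- Both isomorphisms are chosen before `a`, so the same pair serves for the two terms compared in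
-- (A3).
theorem exists_den_nums : ∀ n : ℕ, ∃ (u : 𝟙_ C ≅ tens n fun _ => 𝟙_ C)
    (r : (tens n fun _ => P.real) ≅ P.ty (.Rpow n)), ∀ a : Fin (n + 1) → ℝ,
      P.Den [] (.nums n a) (.Rpow n) (u.hom ≫ tensHom n (fun i => P.num (a i)) ≫ r.hom)
  | 0 => ⟨Iso.refl _, Iso.refl _, fun a => (P.den_num (a 0)).congr_hom
      ((Category.id_comp _).trans (Category.comp_id _)).symm⟩
  | n + 1 => by
    obtain ⟨u, r, h⟩ := exists_den_nums n
    refine ⟨(λ_ _).symm ≪≫ whiskerRightIso u _, whiskerRightIso r _, fun a =>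
      (P.den_tensor .nil (h _) (P.den_num _)).congr_hom ?_⟩
    exact leftUnitor_inv_tensorHom _ _ _ _

/-! ### Commuting conversions and soundness of the equational theory -/

variable [∀ X Y : C, PseudoEMetricSpace (X ⟶ Y)] [MetEnriched C]

/-- The hole is filled in two ways: with the whole `let`, where the variables of `M` pass through
the context, and with `N` alone, where no extra variable passes. `letStar_natural` compares the two.
-/
theorem Den.starComm {Γ : Env} {τ : Ty} {M N : Tm S} {K : Ctx S} {g : P.env Γ ⟶ P.ty τ}
    (hM : Disjoint K.bound M.fv) (h : P.Den Γ (K.fill (.letStar M N)) τ g) :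
    P.Den Γ (.letStar M (K.fill N)) τ g := by
  obtain ⟨Θ, π, _, ⟨D, rfl⟩, hΘ⟩ := h.fillable
  cases D with
  | @letStar Γ₁ Θ₀ _ _ _ _ D₁ D₂ n =>
    have hB : ∀ z ∈ Env.vars Γ₁, z ∉ K.bound := fun z hz hz' =>
      Finset.disjoint_left.1 hM hz' ((D₁.mem_vars z).1 hz)
    obtain ⟨Γ₀, m, F, hF⟩ := hΘ _ _ n hB
    have h₁ := hF.fill m n hB ⟨.letStar D₁ D₂ n, rfl⟩
    have h₂ := hF.fill (Merge.nilLeft _ m.nodup_right) (Merge.nilLeft _ n.nodup_right)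
      (by simp [Env.vars]) ⟨D₂, rfl⟩
    refine (P.den_letStar m ⟨D₁, rfl⟩ h₂).congr_hom (.trans ?_ (h₁.eq h))
    rw [merge_nilLeft]
    simp only [interp]
    exact congrArg _ (letStar_natural hF.natural _ _ _ (P.isIso_merge _) (P.merge_nilLeft _ _))

theorem Den.pairComm {Γ : Env} {τ : Ty} {x y : Var} {M N : Tm S} {K : Ctx S}
    {g g' : P.env Γ ⟶ P.ty τ} (hM : Disjoint K.bound M.fv) (hx : x ∉ K.bound) (hy : y ∉ K.bound)
    (h : P.Den Γ (K.fill (.letPair x y M N)) τ g) (h' : P.Den Γ (.letPair x y M (K.fill N)) τ g') :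
    P.Den Γ (.letPair x y M (K.fill N)) τ g := by
  obtain ⟨Θ, π, _, ⟨D, rfl⟩, hΘ⟩ := h.fillable
  cases D with
  | @letPair Γ₁ Θ₀ _ _ _ σ₁ σ₂ _ _ _ D₁ D₂ n =>
    have hB : ∀ z ∈ Env.vars Γ₁, z ∉ K.bound := fun z hz hz' =>
      Finset.disjoint_left.1 hM hz' ((D₁.mem_vars z).1 hz)
    obtain ⟨Γ₀, m, F, hF⟩ := hΘ _ _ n hB
    have h₁ := hF.fill m n hB ⟨.letPair D₁ D₂ n, rfl⟩
    -- Freshness of `x` and `y` for the rest of the context does not follow from the right-hand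
    -- side. It comes from the typing of the left-hand side, where they are bound around all of
    -- K[N].
    obtain ⟨hx₀, hy₀⟩ : x ∉ Γ₀.vars ∧ y ∉ Env.vars ((x, σ₁) :: Γ₀) := by
      obtain ⟨D', -⟩ := h'
      cases D' with
      | letPair D₁' D₂' m' =>
        obtain ⟨-, rfl, -⟩ := m'.unique m fun z => by rw [D₁'.mem_vars, D₁.mem_vars]
        have hy := Env.nodup_cons.1 D₂'.nodup
        exact ⟨(Env.nodup_cons.1 hy.2).1, hy.1⟩
    have hy₂ := Env.nodup_cons.1 D₂.nodup
    have hx₂ := Env.nodup_cons.1 hy₂.2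
    -- Now `x` and `y` are the variables that enter the hole from outside, which is allowed because
    -- the context binds neither.
    have h₂ := hF.fill (Merge.pair x y σ₁ σ₂ hx₀ hy₀ m.nodup_right)
      (Merge.pair x y σ₁ σ₂ hx₂.1 hy₂.1 hx₂.2) (by simp [Env.vars, hx, hy]) ⟨D₂, rfl⟩
    refine (P.den_letPair m ⟨D₁, rfl⟩ h₂).congr_hom (.trans ?_ (h₁.eq h))
    simp only [interp]
    exact congrArg _ (letPair_natural hF.natural _ _ _ (P.isIso_merge _)
      (braiding_merge_pair hx₀ hy₀ _)
      (braiding_merge_pair hx₂.1 hy₂.1 _))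

/-- Each rule is transferred from the side whose typing determines that of the other; for the η
rules and commuting conversions this is the right-hand side. -/
theorem den_eq_of_equal (M1 : ∀ (f : S) (a : Fin (f.1.n + 1) → ℝ) (b : ℝ), f.1.fn a = b →
      P.den (typed_fn_nums f a) = P.den (typed_num b)) {Γ : Env} {τ : Ty} {M N : Term S Γ τ}
    (h : Equal M N) : P.den M.2 = P.den N.2 := by
  induction h with
  | refl => rfl
  | symm _ ih => exact ih.symm
  | trans _ _ ih₁ ih₂ => exact ih₁.trans ih₂
  | @ctx _ _ _ _ K hK M N _ ih =>
    obtain ⟨G, -, hG⟩ := P.exists_den_fill hK M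
    rw [hG, hG, ih]
  | alphaLam hz h h' => exact (((P.den_den h).alphaLam hz).den_eq h').symm
  | alphaLetPair hzw hz hw h h' => exact (((P.den_den h).alphaLetPair hzw hz hw).den_eq h').symm
  | fn f a b hb h h' => exact M1 f a b hb
  | beta h h' => exact ((P.den_den h).beta.den_eq h').symm
  | eta hx h h' => exact ((P.den_den h').eta hx).den_eq h
  | starBeta h h' => exact ((P.den_den h).starBeta.den_eq h').symm
  | pairBeta h h' => exact ((P.den_den h).pairBeta.den_eq h').symm
  | starEta h h' => exact (P.den_den h').starEta.den_eq h
  | pairEta h h' =>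
    refine ((P.den_den h').pairEta ?_).den_eq h
    -- The two variables of a typed `let` are distinct because its environments have no repetition.
    obtain ⟨D⟩ := h
    cases D with
    | letPair _ D _ => exact fun e => (Env.nodup_cons.1 D.nodup).1 (e ▸ List.mem_cons_self)
  | starComm K hM h h' => exact ((P.den_den h').starComm hM).den_eq h
  | pairComm K hM hx hy h h' => exact ((P.den_den h').pairComm hM hx hy (P.den_den h)).den_eq h

theorem sum_le_edist_nums (M3 : ∀ (X : C) (x y : 𝟙_ C ⟶ X) (n : ℕ) (a b : Fin (n + 1) → ℝ),
      ∑ i, ENNReal.ofReal |a i - b i| ≤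
        edist (tensHom n (fun i => P.num (a i)) ⊗ₘ x) (tensHom n (fun i => P.num (b i)) ⊗ₘ y))
    (n : ℕ) (a b : Fin (n + 1) → ℝ) (τ : Ty) (V U : Term S [] τ) :
    ∑ i, ENNReal.ofReal |a i - b i| ≤
      edist (P.den (typed_tensor (typed_nums n a) V.2))
        (P.den (typed_tensor (typed_nums n b) U.2)) := by
  obtain ⟨u, r, h⟩ := P.exists_den_nums n
  refine (M3 _ (P.den V.2) (P.den U.2) n a b).trans ?_
  rw [(P.den_tensor .nil (h a) (P.den_den V.2)).den_eq,
    (P.den_tensor .nil (h b) (P.den_den U.2)).den_eq]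
  exact edist_le_edist_leftUnitor_inv_tensorHom u r _ _ _ _

end PreModel

end LambdaS

theorem mainTheorem6 (S : Set LambdaS.FunSym)
    (C : Type u) [Category.{v} C] [MonoidalCategory C] [SymmetricCategory C] [MonoidalClosed C]
    [∀ X Y : C, PseudoEMetricSpace (X ⟶ Y)] [LambdaS.MetEnriched C]
    (P : LambdaS.PreModel C S) (hP : P.IsModel) :
    (∀ (τ : LambdaS.Ty) (M V : LambdaS.Term S [] τ), LambdaS.IsValue V.1 →
      LambdaS.Eval M.1 V.1 → P.den M.2 = P.den V.2) ∧
    LambdaS.IsMetric P.dist ∧ LambdaS.IsAdmissible P.dist := by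
  refine ⟨fun τ M V _ e => (((P.den_den M.2).eval e hP.M1).den_eq V.2).symm,
    ⟨fun _ _ _ => edist_self _, fun _ _ _ _ => edist_comm _ _,
      fun _ _ _ _ _ => edist_triangle _ _ _⟩, ⟨?_, ?_, ?_, ?_⟩⟩
  · intro Γ τ M N Δ σ K hK
    obtain ⟨G, hG, hG'⟩ := P.exists_den_fill hK M
    simp only [LambdaS.PreModel.dist, hG']
    exact hG _ _
  · intro a b
    simp only [LambdaS.PreModel.dist, (P.den_num _).den_eq]
    exact hP.M2 a b
  · intro n a b τ V U _ _
    exact LambdaS.PreModel.sum_le_edist_nums hP.M3 n a b τ V U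
  · intro Γ τ M N h
    simp only [LambdaS.PreModel.dist, LambdaS.PreModel.den_eq_of_equal hP.M1 h]
    exact edist_self _
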